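/- Rings are associative with unit. Let $k$ be a commutative artinian ring, let $A$ and $B$ be artin $k$-algebras (that is, $k$-algebras that are finitely generated as $k$-modules), and let $\lambda:A\to B$ be an injective homomorphism of $k$-algebras that is an epimorphism in the category of rings. View $B$ as an $A$-$A$-bimodule via $\lambda$, and suppose that the right $A$-module $B_A$ has projective dimension at most $1$ and that $\mathrm{Tor}_1^A(B,B)=0$. Let $C=\mathrm{End}_A(B/\lambda(A))$ be the endomorphism ring of the right $A$-module $B/\lambda(A)$, and let $\mu:A\to C$ be the ring homomorphism given by the left $A$-module structure of $B/\lambda(A)$, that is, $\mu(a)(b+\lambda(A))=\lambda(a)b+\lambda(A)$. Then $\mu$ is a homological epimorphism, i.e. an epimorphism in the category of rings with $\mathrm{Tor}_i^A(C,C)=0$ for all $i\ge 1$, and $C$, viewed as a left $A$-module via $\mu$, has projective dimension at most $1$. If, moreover, the left $A$-module $\mathrm{Ext}^1_A(B_A,A_A)$ (with the left action induced by left multiplication on the second argument $A$) has projective dimension at most $1$, then $\mu$ has a stratifying kernel: there is an idempotent $e\in A$ with $\ker\mu=AeA$, and the quotient map $A\to A/\ker\mu$ is a homological epimorphism. -/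

import Mathlib

universe u

open CategoryTheory MulOpposite
open scoped TensorProduct

/-!
Rings are associative and unital, not necessarily commutative. Right `A`-modules are modules over
the opposite ring `Aᵐᵒᵖ`, where `op a • m` stands for `m a`.
-/

noncomputable section

namespace RingEpi

section Tensor

variable (A : Type u) [Ring A]

/-- The subgroup of `M ⊗[ℤ] N` generated by the elements `m a ⊗ n - m ⊗ a n`. -/
def balancedRel (M N : Type u) [AddCommGroup M] [Module Aᵐᵒᵖ M] [AddCommGroup N] [Module A N] :
    AddSubgroup (M ⊗[ℤ] N) :=
  AddSubgroup.closure {x | ∃ (m : M) (a : A) (n : N), x = (op a • m) ⊗ₜ[ℤ] n - m ⊗ₜ[ℤ] (a • n)}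

/-- The tensor product over `A` of a right `A`-module and a left `A`-module. -/
abbrev Tensor (M N : Type u) [AddCommGroup M] [Module Aᵐᵒᵖ M] [AddCommGroup N] [Module A N] :
    Type u :=
  (M ⊗[ℤ] N) ⧸ balancedRel A M N

variable {A}

/-- The elementary tensor `m ⊗ n`. -/
def tmul {M N : Type u} [AddCommGroup M] [Module Aᵐᵒᵖ M] [AddCommGroup N] [Module A N]
    (m : M) (n : N) : Tensor A M N :=
  QuotientAddGroup.mk (m ⊗ₜ[ℤ] n)

theorem tensor_hom_ext {M N : Type u} [AddCommGroup M] [Module Aᵐᵒᵖ M] [AddCommGroup N]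
    [Module A N] {P : Type u} [AddCommGroup P] {g h : Tensor A M N →+ P}
    (H : ∀ m n, g (tmul m n) = h (tmul m n)) : g = h := by
  ext x
  induction x using TensorProduct.induction_on with
  | zero => exact (map_zero g).trans (map_zero h).symm
  | tmul m n => exact H m n
  | add x y hx hy =>
    simp only [AddMonoidHom.comp_apply, map_add] at hx hy ⊢
    rw [hx, hy]

/-- The map `g ⊗ N : M ⊗ N → M' ⊗ N` induced by a map `g : M → M'` of right `A`-modules. -/
def tensorMap {M M' : Type u} [AddCommGroup M] [Module Aᵐᵒᵖ M] [AddCommGroup M'] [Module Aᵐᵒᵖ M']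
    (N : Type u) [AddCommGroup N] [Module A N] (g : M →ₗ[Aᵐᵒᵖ] M') :
    Tensor A M N →+ Tensor A M' N :=
  QuotientAddGroup.map (balancedRel A M N) (balancedRel A M' N)
    (LinearMap.rTensor N g.toAddMonoidHom.toIntLinearMap).toAddMonoidHom (by
      refine (AddSubgroup.closure_le _).2 ?_
      rintro _ ⟨m, a, n, rfl⟩
      refine AddSubgroup.subset_closure ⟨g m, a, n, ?_⟩
      rw [map_sub]
      exact congrArg (fun z => z ⊗ₜ[ℤ] n - g m ⊗ₜ[ℤ] (a • n)) (map_smul g (op a) m))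

/-- The functor `- ⊗ N` from right `A`-modules to abelian groups. -/
def tensorFunctor (N : ModuleCat.{u} A) : ModuleCat.{u} Aᵐᵒᵖ ⥤ AddCommGrpCat.{u} where
  obj M := AddCommGrpCat.of (Tensor A M N)
  map g := AddCommGrpCat.ofHom (tensorMap N g.hom)
  map_id _ := AddCommGrpCat.hom_ext (tensor_hom_ext fun _ _ => rfl)
  map_comp _ _ := AddCommGrpCat.hom_ext (tensor_hom_ext fun _ _ => rfl)

instance (N : ModuleCat.{u} A) : (tensorFunctor N).Additive where
  map_add {_ _ g h} := AddCommGrpCat.hom_ext <| tensor_hom_ext fun m n =>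
    congrArg QuotientAddGroup.mk (TensorProduct.add_tmul (g.hom m) (h.hom m) n)

/-- `Tor_i^A(M, N)`, the value at `M` of the `i`-th left derived functor of `- ⊗ N`. -/
def Tor (i : ℕ) (M : ModuleCat.{u} Aᵐᵒᵖ) (N : ModuleCat.{u} A) : AddCommGrpCat.{u} :=
  ((tensorFunctor N).leftDerived i).obj M

end Tensor

section Epi

variable {A B : Type u} [Ring A] [Ring B]

/-- `B` as a right `A`-module along a ring homomorphism `f : A → B`. -/
abbrev rightModule (f : A →+* B) : ModuleCat.{u} Aᵐᵒᵖ :=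
  (ModuleCat.restrictScalars (RingHom.op f)).obj (ModuleCat.of Bᵐᵒᵖ B)

/-- `B` as a left `A`-module along a ring homomorphism `f : A → B`. -/
abbrev leftModule (f : A →+* B) : ModuleCat.{u} A :=
  (ModuleCat.restrictScalars f).obj (ModuleCat.of B B)

/-- An epimorphism in the category of rings. -/
def IsRingEpi (f : A →+* B) : Prop :=
  Epi (RingCat.ofHom f)

/-- A ring epimorphism `A → B` with `Tor_i^A(B, B) = 0` for all `i ≥ 1`. -/
def IsHomologicalEpi (f : A →+* B) : Prop :=
  IsRingEpi f ∧ ∀ i : ℕ, 1 ≤ i → Limits.IsZero (Tor i (rightModule f) (leftModule f))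

/-- A two-sided ideal `I` of the form `A e A` with `e` idempotent, for which `A → A / I` is a
homological epimorphism. -/
def IsStratifyingIdeal (I : Ideal A) [I.IsTwoSided] : Prop :=
  (∃ e : A, IsIdempotentElem e ∧ I = Ideal.span {x | ∃ a b : A, x = a * e * b}) ∧
    IsHomologicalEpi (Ideal.Quotient.mk I)

end Epi

section EndCoker

variable {A B : Type u} [Ring A] [Ring B] (f : A →+* B)

/-- The image of `f : A → B` as a right `A`-submodule of `B`. -/
def imageRight : Submodule Aᵐᵒᵖ (rightModule f) where
  carrier := {b | ∃ a : A, f a = b}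
  add_mem' := by
    rintro _ _ ⟨a, rfl⟩ ⟨a', rfl⟩
    exact ⟨a + a', map_add f a a'⟩
  zero_mem' := ⟨0, map_zero f⟩
  smul_mem' := by
    rintro c _ ⟨a, rfl⟩
    exact ⟨a * unop c, map_mul f a (unop c)⟩

/-- The right `A`-module `B / f(A)`. -/
abbrev Coker : Type u := rightModule f ⧸ imageRight f

/-- The endomorphism ring of the right `A`-module `B / f(A)`. -/
abbrev EndCoker : Type u := Module.End Aᵐᵒᵖ (Coker f)

/-- Left multiplication by `f a` on `B`, as an endomorphism of the right `A`-module `B`. -/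
def mulLeftRight (a : A) : Module.End Aᵐᵒᵖ (rightModule f) where
  toFun b := (f a * (show B from b) : B)
  map_add' b b' := mul_add (f a) (show B from b) (show B from b')
  map_smul' c b := (mul_assoc (f a) (show B from b) (f (unop c))).symm

/-- The ring homomorphism `μ : A → End_A(B / f(A))` given by the left `A`-module structure of
`B / f(A)`. -/
def mu : A →+* EndCoker f where
  toFun a := (imageRight f).mapQ (imageRight f) (mulLeftRight f a) (by
    rintro _ ⟨a', rfl⟩
    exact ⟨a * a', map_mul f a a'⟩)
  map_one' := Submodule.linearMap_qext _ <| LinearMap.ext fun b =>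
    congrArg (imageRight f).mkQ (show f 1 * (show B from b) = b by rw [map_one, one_mul])
  map_mul' a a' := Submodule.linearMap_qext _ <| LinearMap.ext fun b =>
    congrArg (imageRight f).mkQ
      (show f (a * a') * (show B from b) = f a * (f a' * (show B from b)) by
        rw [map_mul, mul_assoc])
  map_zero' := Submodule.linearMap_qext _ <| LinearMap.ext fun b =>
    congrArg (imageRight f).mkQ (show f 0 * (show B from b) = 0 by rw [map_zero, zero_mul])
  map_add' a a' := Submodule.linearMap_qext _ <| LinearMap.ext fun b =>
    congrArg (imageRight f).mkQ
      (show f (a + a') * (show B from b) = f a * (show B from b) + f a' * (show B from b) by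
        rw [map_add, add_mul])

end EndCoker

section ExtModule

variable {A : Type u} [Ring A]

/-- Left multiplication by `a` as an endomorphism of the right `A`-module `A`. -/
def regularMulLeft (a : A) : ModuleCat.of Aᵐᵒᵖ A ⟶ ModuleCat.of Aᵐᵒᵖ A :=
  ModuleCat.ofHom
    { toFun := fun x => a * x
      map_add' := mul_add a
      map_smul' := fun c x => (mul_assoc a x (unop c)).symm }

/-- The left `A`-module structure of `Ext^n_A(X, A)`, for a right `A`-module `X`, that is induced
by the left multiplications on the second argument `A`. -/
abbrev extModule (X : ModuleCat.{u} Aᵐᵒᵖ) (n : ℕ) :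
    Module A (Abelian.Ext.{u} X (ModuleCat.of Aᵐᵒᵖ A) n) where
  smul a x := x.comp (Abelian.Ext.mk₀ (regularMulLeft a)) (add_zero n)
  one_smul x := by
    have h : regularMulLeft (1 : A) = 𝟙 _ := ModuleCat.hom_ext (LinearMap.ext fun y => one_mul y)
    change x.comp (Abelian.Ext.mk₀ (regularMulLeft 1)) (add_zero n) = x
    rw [h, Abelian.Ext.comp_mk₀_id]
  mul_smul a b x := by
    have h : regularMulLeft (a * b) = regularMulLeft b ≫ regularMulLeft a :=
      ModuleCat.hom_ext (LinearMap.ext fun y => mul_assoc a b y)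
    change x.comp (Abelian.Ext.mk₀ (regularMulLeft (a * b))) (add_zero n) =
      (x.comp (Abelian.Ext.mk₀ (regularMulLeft b)) (add_zero n)).comp
        (Abelian.Ext.mk₀ (regularMulLeft a)) (add_zero n)
    rw [h, ← Abelian.Ext.mk₀_comp_mk₀, Abelian.Ext.comp_assoc_of_third_deg_zero]
  smul_zero a := Abelian.Ext.zero_comp _ _ _ _ (add_zero n)
  smul_add a x y := Abelian.Ext.add_comp _ _ _ _
  add_smul a b x := by
    have h : regularMulLeft (a + b) = regularMulLeft a + regularMulLeft b :=
      ModuleCat.hom_ext (LinearMap.ext fun y => add_mul a b y)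
    change x.comp (Abelian.Ext.mk₀ (regularMulLeft (a + b))) (add_zero n) =
      x.comp (Abelian.Ext.mk₀ (regularMulLeft a)) (add_zero n) +
        x.comp (Abelian.Ext.mk₀ (regularMulLeft b)) (add_zero n)
    rw [h, Abelian.Ext.mk₀_add, Abelian.Ext.comp_add]
  zero_smul x := by
    have h : regularMulLeft (0 : A) = 0 := ModuleCat.hom_ext (LinearMap.ext fun y => zero_mul y)
    change x.comp (Abelian.Ext.mk₀ (regularMulLeft 0)) (add_zero n) = 0
    rw [h, Abelian.Ext.mk₀_zero, Abelian.Ext.comp_zero]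

/-- The left `A`-module `Ext^n_A(X, A)` for a right `A`-module `X`. -/
def extLeft (X : ModuleCat.{u} Aᵐᵒᵖ) (n : ℕ) : ModuleCat.{u} A :=
  letI := extModule X n
  ModuleCat.of A (Abelian.Ext.{u} X (ModuleCat.of Aᵐᵒᵖ A) n)

end ExtModule

end RingEpi

end

/-! Write f for `lam`. Choose finitely many `b i` generating B as a right A-module and let K =
`relations f b` be the kernel of the induced map A^n → B/f(A). Since 0 → K → A × A^n → B → 0 is
exact and B has projective dimension at most 1, K is projective; it is finitely generated because A
is noetherian on the right.

The key is to realise K* = Hom_A(K, A) inside B^n. As f is an epimorphism, (B/f(A)) ⊗ B = 0;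
together with Tor_1(B, B) = 0 this makes K ⊗ B → A^n ⊗ B = B^n bijective. By adjunction every
A-linear map K → B has the form v ↦ ∑ β i f(v i) for a unique β in B^n. So K* is `dual f b`, the set
of those β that send K into f(A), and it is a projective left module. Each such β also induces an
endomorphism of B/f(A). Every endomorphism arises in this way, and β induces zero exactly when its
entries lie in f(A). Hence 0 → A^n → K* → C → 0 is a projective resolution of C.

Tensoring it with C on the left gives Hom(A^n, C) → Hom(K, C). The kernel is Hom(B/f(A), C) =
Hom((B/f(A)) ⊗ (B/f(A)), B/f(A)) = 0, which gives the vanishing of Tor. The identity c ⊗ 1 = 1 ⊗ c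
in C ⊗ C, which makes μ an epimorphism, is checked in C ⊗ K* = Hom(K, C) modulo the maps that extend
to A^n.

Dualising the resolution of B gives a map A × A^n → K* with cokernel Ext^1(B, A). Its kernel
Hom_A(B, A) is identified with I = ker μ by projecting to the first coordinate. If the Ext module
has projective dimension at most 1, the image is projective, so I is a direct summand of A × A^n,
and the coordinates of the splitting force I = I². A projective idempotent ideal satisfies (A/I) ⊗ I
= 0, which makes A → A/I homological; in an artinian ring an idempotent ideal is generated by an
idempotent element. -/

noncomputable section

namespace RingEpi

/-! ### Tensor products over noncommutative rings: exactness and flatness. -/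

section TensorLemmas

variable {A : Type u} [Ring A]

section Basic

variable {M N : Type u} [AddCommGroup M] [Module Aᵐᵒᵖ M] [AddCommGroup N] [Module A N]

theorem tmul_add (m : M) (n n' : N) : tmul (A := A) m (n + n') = tmul m n + tmul m n' :=
  congrArg QuotientAddGroup.mk (TensorProduct.tmul_add m n n')

theorem add_tmul (m m' : M) (n : N) : tmul (A := A) (m + m') n = tmul m n + tmul m' n :=
  congrArg QuotientAddGroup.mk (TensorProduct.add_tmul m m' n)

theorem smul_tmul (m : M) (a : A) (n : N) : tmul (A := A) (op a • m) n = tmul m (a • n) := by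
  refine sub_eq_zero.1 ?_
  exact (QuotientAddGroup.eq_zero_iff _).2 (AddSubgroup.subset_closure ⟨m, a, n, rfl⟩)

theorem tensor_induction {p : Tensor A M N → Prop} (h0 : p 0)
    (ht : ∀ m n, p (tmul m n)) (ha : ∀ x y, p x → p y → p (x + y)) (z : Tensor A M N) : p z := by
  obtain ⟨x, rfl⟩ := QuotientAddGroup.mk_surjective z
  induction x using TensorProduct.induction_on with
  | zero => exact h0
  | tmul m n => exact ht m n
  | add x y hx hy => exact ha _ _ hx hy

/-- The bi-additive map `(m, n) ↦ m ⊗ n`. -/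
def tmulHom (M N : Type u) [AddCommGroup M] [Module Aᵐᵒᵖ M] [AddCommGroup N] [Module A N] :
    M →+ N →+ Tensor A M N :=
  AddMonoidHom.mk' (fun m => AddMonoidHom.mk' (fun n => tmul m n) (tmul_add m))
    fun m m' => AddMonoidHom.ext fun n => add_tmul m m' n

theorem zero_tmul (n : N) : tmul (A := A) (0 : M) n = 0 :=
  map_zero ((tmulHom M N).flip n)

theorem tmul_zero (m : M) : tmul (A := A) m (0 : N) = 0 :=
  map_zero (tmulHom M N m)

theorem sub_tmul (m m' : M) (n : N) : tmul (A := A) (m - m') n = tmul m n - tmul m' n :=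
  map_sub ((tmulHom M N).flip n) m m'

theorem tmul_sub (m : M) (n n' : N) : tmul (A := A) m (n - n') = tmul m n - tmul m n' :=
  map_sub (tmulHom M N m) n n'

theorem sum_tmul {ι : Type*} (s : Finset ι) (m : ι → M) (n : N) :
    tmul (A := A) (∑ i ∈ s, m i) n = ∑ i ∈ s, tmul (m i) n :=
  map_sum ((tmulHom M N).flip n) m s

theorem tmul_sum {ι : Type*} (s : Finset ι) (m : M) (n : ι → N) :
    tmul (A := A) m (∑ i ∈ s, n i) = ∑ i ∈ s, tmul m (n i) :=
  map_sum (tmulHom M N m) n s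

/-- The universal property of the tensor product. -/
def tensorLift {P : Type*} [AddCommGroup P] (φ : M →+ N →+ P)
    (h : ∀ m (a : A) n, φ (op a • m) n = φ m (a • n)) : Tensor A M N →+ P :=
  QuotientAddGroup.lift (balancedRel A M N)
    (TensorProduct.liftAddHom φ fun r m n => by simp) (by
      refine (AddSubgroup.closure_le _).2 ?_
      rintro _ ⟨m, a, n, rfl⟩
      simp [h])

@[simp]
theorem tensorLift_tmul {P : Type*} [AddCommGroup P] (φ : M →+ N →+ P)
    (h : ∀ m (a : A) n, φ (op a • m) n = φ m (a • n)) (m : M) (n : N) :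
    tensorLift φ h (tmul m n) = φ m n := rfl

end Basic

variable {M M' N N' : Type u} [AddCommGroup M] [Module Aᵐᵒᵖ M] [AddCommGroup M'] [Module Aᵐᵒᵖ M']
  [AddCommGroup N] [Module A N] [AddCommGroup N'] [Module A N']

@[simp]
theorem tensorMap_tmul (g : M →ₗ[Aᵐᵒᵖ] M') (m : M) (n : N) :
    tensorMap N g (tmul m n) = tmul (g m) n := rfl

/-- The map `M ⊗ h : M ⊗ N → M ⊗ N'` induced by a map `h : N → N'` of left `A`-modules. -/
def tensorMapRight (M : Type u) [AddCommGroup M] [Module Aᵐᵒᵖ M] (h : N →ₗ[A] N') :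
    Tensor A M N →+ Tensor A M N' :=
  tensorLift (AddMonoidHom.mk' (fun m => (tmulHom M N' m).comp h.toAddMonoidHom)
    fun m m' => AddMonoidHom.ext fun n => add_tmul m m' (h n)) fun m a n => by
      change tmul (op a • m) (h n) = tmul m (h (a • n))
      rw [smul_tmul, map_smul]

@[simp]
theorem tensorMapRight_tmul (h : N →ₗ[A] N') (m : M) (n : N) :
    tensorMapRight M h (tmul m n) = tmul m (h n) := rfl

theorem tensorMapRight_tensorMap (g : M →ₗ[Aᵐᵒᵖ] M') (h : N →ₗ[A] N') (z : Tensor A M N) :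
    tensorMapRight M' h (tensorMap N g z) = tensorMap N' g (tensorMapRight M h z) :=
  DFunLike.congr_fun (tensor_hom_ext (g := (tensorMapRight M' h).comp (tensorMap N g))
    (h := (tensorMap N' g).comp (tensorMapRight M h)) fun _ _ => rfl) z

theorem tensorMap_comp_apply {M'' : Type u} [AddCommGroup M''] [Module Aᵐᵒᵖ M'']
    (g : M →ₗ[Aᵐᵒᵖ] M') (g' : M' →ₗ[Aᵐᵒᵖ] M'') (z : Tensor A M N) :
    tensorMap N (g' ∘ₗ g) z = tensorMap N g' (tensorMap N g z) :=
  DFunLike.congr_fun (tensor_hom_ext (g := tensorMap N (g' ∘ₗ g))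
    (h := (tensorMap N g').comp (tensorMap N g)) fun _ _ => rfl) z

theorem tensorMap_surjective (g : M →ₗ[Aᵐᵒᵖ] M') (hg : Function.Surjective g) :
    Function.Surjective (tensorMap N g) := by
  intro z
  induction z using tensor_induction with
  | h0 => exact ⟨0, map_zero _⟩
  | ht m n =>
    obtain ⟨m, rfl⟩ := hg m
    exact ⟨tmul m n, rfl⟩
  | ha x y hx hy =>
    obtain ⟨x, rfl⟩ := hx
    obtain ⟨y, rfl⟩ := hy
    exact ⟨x + y, map_add _ _ _⟩

theorem tensorMapRight_surjective (h : N →ₗ[A] N') (hh : Function.Surjective h) :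
    Function.Surjective (tensorMapRight M h) := by
  intro z
  induction z using tensor_induction with
  | h0 => exact ⟨0, map_zero _⟩
  | ht m n =>
    obtain ⟨n, rfl⟩ := hh n
    exact ⟨tmul m n, rfl⟩
  | ha x y hx hy =>
    obtain ⟨x, rfl⟩ := hx
    obtain ⟨y, rfl⟩ := hy
    exact ⟨x + y, map_add _ _ _⟩

/-- Right exactness of `- ⊗ N`. -/
theorem tensorMap_exact {K : Type u} [AddCommGroup K] [Module Aᵐᵒᵖ K] (κ : K →ₗ[Aᵐᵒᵖ] M)
    (q : M →ₗ[Aᵐᵒᵖ] M') (hκq : Function.Exact κ q) (hq : Function.Surjective q) :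
    Function.Exact (tensorMap N κ) (tensorMap N q) := by
  intro z
  constructor
  · intro hz
    let Q := Tensor A M N ⧸ (tensorMap N κ).range
    have key (m m' : M) (n : N) (h : q m = q m') :
        (QuotientAddGroup.mk (tmul m n) : Q) = QuotientAddGroup.mk (tmul m' n) := by
      obtain ⟨x, hx⟩ := (hκq (m - m')).1 (by rw [map_sub, h, sub_self])
      rw [← sub_eq_zero, ← QuotientAddGroup.mk_sub, ← sub_tmul, ← hx]
      exact (QuotientAddGroup.eq_zero_iff _).2 ⟨tmul x n, rfl⟩
    -- A set-theoretic section of `q` suffices to map M' ⊗ N back to the cokernel: by `key` the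
    -- class does not depend on the choice of preimage.
    let s := Function.surjInv hq
    have hs := Function.surjInv_eq hq
    let φ : Tensor A M' N →+ Q := tensorLift
      (AddMonoidHom.mk' (fun m => (QuotientAddGroup.mk' _).comp (tmulHom M N (s m)))
        fun m m' => AddMonoidHom.ext fun n => by
          change (QuotientAddGroup.mk (tmul (s (m + m')) n) : Q) =
            QuotientAddGroup.mk (tmul (s m) n) + QuotientAddGroup.mk (tmul (s m') n)
          rw [← QuotientAddGroup.mk_add, ← add_tmul]
          exact key _ _ _ (by rw [map_add, hs, hs, hs]))
      fun m a n => by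
        change (QuotientAddGroup.mk (tmul (s (op a • m)) n) : Q) =
          QuotientAddGroup.mk (tmul (s m) (a • n))
        rw [← smul_tmul]
        exact key _ _ _ (by rw [map_smul, hs, hs])
    have hφ : φ.comp (tensorMap N q) = QuotientAddGroup.mk' _ :=
      tensor_hom_ext fun m n => key _ _ _ (hs (q m))
    have h0 := DFunLike.congr_fun hφ z
    rw [AddMonoidHom.comp_apply, hz, map_zero] at h0
    exact (QuotientAddGroup.eq_zero_iff _).1 h0.symm
  · rintro ⟨x, rfl⟩
    rw [← tensorMap_comp_apply]
    induction x using tensor_induction with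
    | h0 => exact map_zero _
    | ht m n =>
      rw [tensorMap_tmul, LinearMap.comp_apply, (hκq _).2 ⟨m, rfl⟩, zero_tmul]
    | ha x y hx hy => rw [map_add, hx, hy, add_zero]

/-- Right exactness of `M ⊗ -`. -/
theorem tensorMapRight_exact {K : Type u} [AddCommGroup K] [Module A K] (κ : K →ₗ[A] N)
    (q : N →ₗ[A] N') (hκq : Function.Exact κ q) (hq : Function.Surjective q) :
    Function.Exact (tensorMapRight M κ) (tensorMapRight M q) := by
  intro z
  constructor
  · intro hz
    let Q := Tensor A M N ⧸ (tensorMapRight M κ).range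
    have key (m : M) (n n' : N) (h : q n = q n') :
        (QuotientAddGroup.mk (tmul m n) : Q) = QuotientAddGroup.mk (tmul m n') := by
      obtain ⟨x, hx⟩ := (hκq (n - n')).1 (by rw [map_sub, h, sub_self])
      rw [← sub_eq_zero, ← QuotientAddGroup.mk_sub, ← tmul_sub, ← hx]
      exact (QuotientAddGroup.eq_zero_iff _).2 ⟨tmul m x, rfl⟩
    let s := Function.surjInv hq
    have hs := Function.surjInv_eq hq
    let φ : Tensor A M N' →+ Q := tensorLift
      (AddMonoidHom.mk' (fun m => AddMonoidHom.mk' (fun n => QuotientAddGroup.mk (tmul m (s n)))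
        fun n n' => by
          rw [← QuotientAddGroup.mk_add, ← tmul_add]
          exact key _ _ _ (by rw [map_add, hs, hs, hs]))
        fun m m' => AddMonoidHom.ext fun n => congrArg QuotientAddGroup.mk (add_tmul m m' (s n)))
      fun m a n => by
        change (QuotientAddGroup.mk (tmul (op a • m) (s n)) : Q) =
          QuotientAddGroup.mk (tmul m (s (a • n)))
        rw [smul_tmul]
        exact key _ _ _ (by rw [map_smul, hs, hs])
    have hφ : φ.comp (tensorMapRight M q) = QuotientAddGroup.mk' _ :=
      tensor_hom_ext fun m n => key _ _ _ (hs (q n))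
    have h0 := DFunLike.congr_fun hφ z
    rw [AddMonoidHom.comp_apply, hz, map_zero] at h0
    exact (QuotientAddGroup.eq_zero_iff _).1 h0.symm
  · rintro ⟨x, rfl⟩
    induction x using tensor_induction with
    | h0 => simp only [map_zero]
    | ht m n =>
      rw [tensorMapRight_tmul, tensorMapRight_tmul, (hκq _).2 ⟨n, rfl⟩, tmul_zero]
    | ha x y hx hy => rw [map_add, map_add, hx, hy, add_zero]

/-- Projective right modules are flat. -/
theorem tensorMapRight_injective_of_projective [Module.Projective Aᵐᵒᵖ M] (h : N →ₗ[A] N')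
    (hh : Function.Injective h) : Function.Injective (tensorMapRight M h) := by
  obtain ⟨s, hs⟩ := Module.projective_def.1 (inferInstance : Module.Projective Aᵐᵒᵖ M)
  -- Dual basis argument: the coordinates of the splitting `s` recover a tensor and are natural in
  -- the second factor.
  let coord (X : Type u) [AddCommGroup X] [Module A X] : Tensor A M X →+ (M → X) :=
    tensorLift (AddMonoidHom.mk'
      (fun m => AddMonoidHom.mk' (fun n i => unop (s m i) • n) fun n n' => by
        ext i; exact smul_add _ _ _)
      fun m m' => by
        ext n i
        change unop (s (m + m') i) • n = unop (s m i) • n + unop (s m' i) • n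
        rw [map_add, Finsupp.add_apply, MulOpposite.unop_add, add_smul])
      fun m a n => by
        ext i
        change unop (s (op a • m) i) • n = unop (s m i) • (a • n)
        rw [map_smul, Finsupp.smul_apply, smul_eq_mul, unop_mul, unop_op, mul_smul]
  -- Allowing every larger finite set lets the supports of two summands be merged.
  have key (z : Tensor A M N) : ∃ t : Finset M, ∀ t' ⊇ t,
      z = ∑ i ∈ t', tmul i (coord N z i) := by
    classical
    induction z using tensor_induction with
    | h0 => exact ⟨∅, fun t' _ => by simp [tmul_zero]⟩
    | ht m n =>
      refine ⟨(s m).support, fun t' ht' => ?_⟩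
      change _ = ∑ i ∈ t', tmul i (unop (s m i) • n)
      have hm := hs m
      rw [Finsupp.linearCombination_apply, Finsupp.sum_of_support_subset _ ht' _ (by simp)] at hm
      conv_lhs => rw [← hm, sum_tmul]
      exact Finset.sum_congr rfl fun i _ => by
        rw [← smul_tmul, op_unop]; rfl
    | ha x y hx hy =>
      obtain ⟨t, ht⟩ := hx
      obtain ⟨t', ht'⟩ := hy
      refine ⟨t ∪ t', fun w hw => ?_⟩
      conv_lhs => rw [ht w (Finset.union_subset_left hw), ht' w (Finset.union_subset_right hw)]
      rw [← Finset.sum_add_distrib]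
      simp only [map_add, Pi.add_apply, tmul_add]
  have nat (z : Tensor A M N) (i : M) : coord N' (tensorMapRight M h z) i = h (coord N z i) := by
    induction z using tensor_induction with
    | h0 => simp
    | ht m n => exact (map_smul h _ _).symm
    | ha x y hx hy => simp only [map_add, Pi.add_apply, hx, hy]
  refine (injective_iff_map_eq_zero _).2 fun z hz => ?_
  obtain ⟨t, ht⟩ := key z
  rw [ht t subset_rfl]
  refine Finset.sum_eq_zero fun i _ => ?_
  have : coord N z i = 0 := hh (by rw [← nat, hz, map_zero, map_zero]; rfl)
  rw [this, tmul_zero]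

/-- Projective left modules are flat. -/
theorem tensorMap_injective_of_projective [Module.Projective A N] (g : M →ₗ[Aᵐᵒᵖ] M')
    (hg : Function.Injective g) : Function.Injective (tensorMap N g) := by
  obtain ⟨s, hs⟩ := Module.projective_def.1 (inferInstance : Module.Projective A N)
  let coord (X : Type u) [AddCommGroup X] [Module Aᵐᵒᵖ X] : Tensor A X N →+ (N → X) :=
    tensorLift (AddMonoidHom.mk'
      (fun m => AddMonoidHom.mk' (fun n i => op (s n i) • m) fun n n' => by
        ext i
        change op (s (n + n') i) • m = op (s n i) • m + op (s n' i) • m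
        rw [map_add, Finsupp.add_apply, MulOpposite.op_add, add_smul])
      fun m m' => by
        ext n i; exact smul_add _ _ _)
      fun m a n => by
        ext i
        change op (s n i) • (op a • m) = op (s (a • n) i) • m
        rw [map_smul, Finsupp.smul_apply, smul_eq_mul, op_mul, mul_smul]
  have key (z : Tensor A M N) : ∃ t : Finset N, ∀ t' ⊇ t,
      z = ∑ i ∈ t', tmul (coord M z i) i := by
    classical
    induction z using tensor_induction with
    | h0 => exact ⟨∅, fun t' _ => by simp [zero_tmul]⟩
    | ht m n =>
      refine ⟨(s n).support, fun t' ht' => ?_⟩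
      change _ = ∑ i ∈ t', tmul (op (s n i) • m) i
      have hm := hs n
      rw [Finsupp.linearCombination_apply, Finsupp.sum_of_support_subset _ ht' _ (by simp)] at hm
      conv_lhs => rw [← hm, tmul_sum]
      exact Finset.sum_congr rfl fun i _ => by
        rw [smul_tmul]; rfl
    | ha x y hx hy =>
      obtain ⟨t, ht⟩ := hx
      obtain ⟨t', ht'⟩ := hy
      refine ⟨t ∪ t', fun w hw => ?_⟩
      conv_lhs => rw [ht w (Finset.union_subset_left hw), ht' w (Finset.union_subset_right hw)]
      rw [← Finset.sum_add_distrib]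
      simp only [map_add, Pi.add_apply, add_tmul]
  have nat (z : Tensor A M N) (i : N) : coord M' (tensorMap N g z) i = g (coord M z i) := by
    induction z using tensor_induction with
    | h0 => simp
    | ht m n => exact (map_smul g _ _).symm
    | ha x y hx hy => simp only [map_add, Pi.add_apply, hx, hy]
  refine (injective_iff_map_eq_zero _).2 fun z hz => ?_
  obtain ⟨t, ht⟩ := key z
  rw [ht t subset_rfl]
  refine Finset.sum_eq_zero fun i _ => ?_
  have : coord M z i = 0 := hg (by rw [← nat, hz, map_zero, map_zero]; rfl)
  rw [this, zero_tmul]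

end TensorLemmas

/-! ### Vanishing of Tor in terms of short exact sequences. -/

section TorLemmas

variable {A : Type u} [Ring A]

/-- By right exactness the cokernel of d ⊗ N is (range e) ⊗ N, so the homology at X₁ ⊗ N is the
kernel of (range e) ⊗ N → X₀ ⊗ N. -/
theorem exact_tensorMap_iff_injective {X₂ X₁ X₀ N : Type u} [AddCommGroup X₂] [Module Aᵐᵒᵖ X₂]
    [AddCommGroup X₁] [Module Aᵐᵒᵖ X₁] [AddCommGroup X₀] [Module Aᵐᵒᵖ X₀] [AddCommGroup N]
    [Module A N] (d : X₂ →ₗ[Aᵐᵒᵖ] X₁) (e : X₁ →ₗ[Aᵐᵒᵖ] X₀) (h : Function.Exact d e) :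
    Function.Exact (tensorMap N d) (tensorMap N e) ↔
      Function.Injective (tensorMap N (LinearMap.range e).subtype) := by
  have hsurj := tensorMap_surjective (N := N) e.rangeRestrict e.surjective_rangeRestrict
  have hex : Function.Exact (tensorMap N d) (tensorMap N e.rangeRestrict) :=
    tensorMap_exact d e.rangeRestrict
      (fun x => by rw [← h x]; exact Subtype.ext_iff) e.surjective_rangeRestrict
  have hcomp (z : Tensor A X₁ N) : tensorMap N (LinearMap.range e).subtype
      (tensorMap N e.rangeRestrict z) = tensorMap N e z :=
    (tensorMap_comp_apply _ _ z).symm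
  constructor
  · intro H
    refine (injective_iff_map_eq_zero _).2 fun z hz => ?_
    obtain ⟨z, rfl⟩ := hsurj z
    rw [hcomp] at hz
    exact (hex z).2 ((H z).1 hz)
  · intro H z
    rw [← hex z, ← hcomp]
    exact map_eq_zero_iff _ H

theorem isZero_tor_succ_iff {M : ModuleCat.{u} Aᵐᵒᵖ} (P : ProjectiveResolution M)
    (N : ModuleCat.{u} A) (n : ℕ) : Limits.IsZero (Tor (n + 1) M N) ↔
      Function.Injective
        (tensorMap N (LinearMap.range (P.complex.d (n + 1) n).hom).subtype) := by
  rw [← exact_tensorMap_iff_injective (P.complex.d (n + 2) (n + 1)).hom]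
  · rw [Tor, (P.isoLeftDerivedObj (tensorFunctor N) (n + 1)).isZero_iff,
      HomologicalComplex.homologyFunctor_obj, ← HomologicalComplex.exactAt_iff_isZero_homology,
      HomologicalComplex.exactAt_iff' _ (n + 2) (n + 1) n (by simp only [ChainComplex.prev]; rfl)
        (by simp), ShortComplex.ab_exact_iff_function_exact]
    rfl
  · exact (ShortComplex.ShortExact.moduleCat_exact_iff_function_exact _).1 (P.exact_succ n)

variable {K F M N₁ N₀ N : Type u} [AddCommGroup K] [Module Aᵐᵒᵖ K] [AddCommGroup F]
  [Module Aᵐᵒᵖ F] [AddCommGroup M] [Module Aᵐᵒᵖ M] [AddCommGroup N₁] [Module A N₁]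
  [AddCommGroup N₀] [Module A N₀] [AddCommGroup N] [Module A N]

/-- Balancing of Tor_1 by a diagram chase: its vanishing is transferred from a resolution of N to a
presentation of M. F need not be projective. -/
theorem tensorMap_injective_of_tensorMapRight_injective [Module.Projective A N₀]
    {κ : K →ₗ[Aᵐᵒᵖ] F} {q : F →ₗ[Aᵐᵒᵖ] M} (hκ : Function.Injective κ)
    (hκq : Function.Exact κ q) (hq : Function.Surjective q)
    {i : N₁ →ₗ[A] N₀} {p : N₀ →ₗ[A] N} (hip : Function.Exact i p) (hp : Function.Surjective p)
    (h : Function.Injective (tensorMapRight M i)) : Function.Injective (tensorMap N κ) := by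
  refine (injective_iff_map_eq_zero _).2 fun z hz => ?_
  obtain ⟨z, rfl⟩ := tensorMapRight_surjective p hp z
  rw [← tensorMapRight_tensorMap] at hz
  obtain ⟨y, hy⟩ := (tensorMapRight_exact i p hip hp _).1 hz
  have hy0 : tensorMap N₁ q y = 0 := h (by
    rw [map_zero, tensorMapRight_tensorMap, hy]
    exact (tensorMap_exact κ q hκq hq _).2 ⟨z, rfl⟩)
  obtain ⟨x, rfl⟩ := (tensorMap_exact κ q hκq hq _).1 hy0
  rw [tensorMapRight_tensorMap] at hy
  exact (tensorMapRight_exact i p hip hp _).2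
    ⟨x, tensorMap_injective_of_projective κ hκ hy⟩

/-- If `0 → N₁ → N₀ → N → 0` is a projective resolution and `M ⊗ N₁ → M ⊗ N₀` is injective, then
`Tor_i(M, N)` vanishes for `i ≥ 1`. -/
theorem isZero_tor_of_projective_resolution [Module.Projective A N₁] [Module.Projective A N₀]
    (M : ModuleCat.{u} Aᵐᵒᵖ) (N : ModuleCat.{u} A) {i : N₁ →ₗ[A] N₀} {p : N₀ →ₗ[A] N}
    (hi : Function.Injective i) (hip : Function.Exact i p) (hp : Function.Surjective p)
    (h : Function.Injective (tensorMapRight M i)) (n : ℕ) (hn : 1 ≤ n) :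
    Limits.IsZero (Tor n M N) := by
  obtain ⟨n, rfl⟩ := Nat.exists_eq_add_of_le' hn
  let P := ProjectiveResolution.of M
  rw [isZero_tor_succ_iff P]
  cases n with
  | zero =>
    refine tensorMap_injective_of_tensorMapRight_injective
      (q := (P.π.f 0).hom) (Submodule.subtype_injective _) ?_ ?_ hip hp h
    · have := (ShortComplex.ShortExact.moduleCat_exact_iff_function_exact _).1 P.exact₀
      intro x
      rw [this x]
      exact ⟨fun ⟨y, hy⟩ => ⟨⟨x, y, hy⟩, rfl⟩, fun ⟨⟨_, y, hy⟩, hx⟩ => ⟨y, hy.trans hx⟩⟩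
    · exact (ModuleCat.epi_iff_surjective _).1 inferInstance
  | succ n =>
    have hex := (ShortComplex.ShortExact.moduleCat_exact_iff_function_exact _).1 (P.exact_succ n)
    refine tensorMap_injective_of_tensorMapRight_injective
      (q := (P.complex.d (n + 1) n).hom.rangeRestrict) (Submodule.subtype_injective _) ?_
      (LinearMap.surjective_rangeRestrict _) hip hp ?_
    · intro x
      refine Subtype.ext_iff.trans ((hex x).trans ?_)
      exact ⟨fun ⟨y, hy⟩ => ⟨⟨x, y, hy⟩, rfl⟩, fun ⟨⟨_, y, hy⟩, hx⟩ => ⟨y, hy.trans hx⟩⟩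
    · have hproj : Module.Projective Aᵐᵒᵖ (P.complex.X n) :=
        (IsProjective.iff_projective _).2 (P.projective n)
      have hι := tensorMap_injective_of_projective (N := N₁)
        (LinearMap.range (P.complex.d (n + 1) n).hom).subtype (Submodule.subtype_injective _)
      -- The syzygy embeds in the projective `P.complex.X n`, and N₁ is flat. So syzygy ⊗ N₁ embeds
      -- in `P.complex.X n` ⊗ N₀, through syzygy ⊗ N₀.
      have hc := (tensorMapRight_injective_of_projective (M := P.complex.X n) i hi).comp hι
      refine (injective_iff_map_eq_zero _).2 fun z hz => ?_
      refine (map_eq_zero_iff ((tensorMapRight (P.complex.X n) i).comp (tensorMap N₁ _)) hc).1 ?_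
      rw [AddMonoidHom.comp_apply, tensorMapRight_tensorMap, hz, map_zero]

/-- If `Tor_1(M, N)` vanishes, then `- ⊗ N` preserves the exactness of every short exact sequence
`0 → K → F → M → 0` with `F` projective. -/
theorem tensorMap_injective_of_isZero_tor_one [Module.Projective Aᵐᵒᵖ F]
    (M : ModuleCat.{u} Aᵐᵒᵖ) (N : ModuleCat.{u} A) (h : Limits.IsZero (Tor 1 M N))
    {κ : K →ₗ[Aᵐᵒᵖ] F} {q : F →ₗ[Aᵐᵒᵖ] M} (hκ : Function.Injective κ)
    (hκq : Function.Exact κ q) (hq : Function.Surjective q) :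
    Function.Injective (tensorMap N κ) := by
  let P := ProjectiveResolution.of M
  rw [isZero_tor_succ_iff P] at h
  set K₀ := LinearMap.range (P.complex.d (0 + 1) 0).hom with hK₀
  have hproj : Module.Projective Aᵐᵒᵖ (P.complex.X 0) :=
    (IsProjective.iff_projective _).2 (P.projective 0)
  let π : P.complex.X 0 →ₗ[Aᵐᵒᵖ] M := (P.π.f 0).hom
  have hπ : Function.Surjective π := (ModuleCat.epi_iff_surjective _).1 inferInstance
  have hπK (x : P.complex.X 0) : π x = 0 ↔ x ∈ K₀ :=
    (ShortComplex.ShortExact.moduleCat_exact_iff_function_exact _).1 P.exact₀ x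
  -- Comparison of the two presentations of M: the composite K → K₀ → K of the induced maps differs
  -- from the identity by a map factoring through κ.
  obtain ⟨α, hα⟩ := Module.projective_lifting_property π q hπ
  obtain ⟨β, hβ⟩ := Module.projective_lifting_property q π hq
  replace hα (x) : π (α x) = q x := LinearMap.congr_fun hα x
  replace hβ (x) : q (β x) = π x := LinearMap.congr_fun hβ x
  let eK := LinearEquiv.ofInjective κ hκ
  have heK (x : LinearMap.range κ) : κ (eK.symm x) = x :=
    congrArg Subtype.val (eK.apply_symm_apply x)
  let α' : K →ₗ[Aᵐᵒᵖ] K₀ := (α ∘ₗ κ).codRestrict K₀ fun x =>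
    (hπK _).1 ((hα _).trans ((hκq _).2 ⟨x, rfl⟩))
  let β' : K₀ →ₗ[Aᵐᵒᵖ] K := eK.symm.toLinearMap ∘ₗ
    (β ∘ₗ K₀.subtype).codRestrict (LinearMap.range κ) fun x =>
      (hκq _).1 ((hβ _).trans ((hπK _).2 x.2))
  let γ : F →ₗ[Aᵐᵒᵖ] K := eK.symm.toLinearMap ∘ₗ
    (β ∘ₗ α - LinearMap.id).codRestrict (LinearMap.range κ) fun x =>
      (hκq _).1 (by simp [hα, hβ])
  have hid : β' ∘ₗ α' = LinearMap.id + γ ∘ₗ κ := by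
    ext x
    apply hκ
    have h1 : κ (β' (α' x)) = β (α (κ x)) := heK _
    have h2 : κ (γ (κ x)) = β (α (κ x)) - κ x := heK _
    simp [h1, h2]
  refine (injective_iff_map_eq_zero _).2 fun z hz => ?_
  have hadd : tensorMap N (β' ∘ₗ α') z = z + tensorMap N γ (tensorMap N κ z) := by
    rw [hid]
    clear hz
    induction z using tensor_induction with
    | h0 => simp only [map_zero, add_zero]
    | ht m n =>
      simp only [tensorMap_tmul, LinearMap.add_apply, add_tmul, LinearMap.id_apply,
        LinearMap.comp_apply]
    | ha x y hx hy =>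
      simp only [map_add, hx, hy]
      abel
  have hα0 : tensorMap N α' z = 0 := h (by
    rw [map_zero, ← tensorMap_comp_apply]
    change tensorMap N (α ∘ₗ κ) z = 0
    rw [tensorMap_comp_apply, hz, map_zero])
  rw [hz, map_zero, add_zero, tensorMap_comp_apply, hα0, map_zero] at hadd
  exact hadd.symm

end TorLemmas

/-! ### Ring epimorphisms, linearity and B ⊗ B. -/

section EpiLemmas

variable {A B : Type u} [Ring A] [Ring B] {f : A →+* B}

/-- Along a ring epimorphism `A → B`, an `A`-linear map between right `B`-modules is
`B`-linear. -/
theorem IsRingEpi.map_smul (hf : IsRingEpi f) {Y Y' : Type u} [AddCommGroup Y] [AddCommGroup Y']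
    (ρ : Bᵐᵒᵖ →+* AddMonoid.End Y) (ρ' : Bᵐᵒᵖ →+* AddMonoid.End Y') (φ : Y →+ Y')
    (hφ : ∀ a y, φ (ρ (op (f a)) y) = ρ' (op (f a)) (φ y)) (b : B) (y : Y) :
    φ (ρ (op b) y) = ρ' (op b) (φ y) := by
  let g₁ : Bᵐᵒᵖ →+* AddMonoid.End (Y × Y') :=
    { toFun := fun c => AddMonoidHom.mk' (fun p : Y × Y' => (ρ c p.1, ρ' c p.2)) fun p p' => by
        simp
      map_one' := DFunLike.ext _ _ fun p => Prod.ext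
        (DFunLike.congr_fun (map_one ρ) p.1) (DFunLike.congr_fun (map_one ρ') p.2)
      map_mul' := fun c d => DFunLike.ext _ _ fun p => Prod.ext
        (DFunLike.congr_fun (map_mul ρ c d) p.1) (DFunLike.congr_fun (map_mul ρ' c d) p.2)
      map_zero' := DFunLike.ext _ _ fun p => Prod.ext
        (DFunLike.congr_fun (map_zero ρ) p.1) (DFunLike.congr_fun (map_zero ρ') p.2)
      map_add' := fun c d => DFunLike.ext _ _ fun p => Prod.ext
        (DFunLike.congr_fun (map_add ρ c d) p.1) (DFunLike.congr_fun (map_add ρ' c d) p.2) }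
  -- Conjugating the diagonal action on Y × Y' by the unipotent automorphism of φ changes nothing on
  -- A, since φ is A-linear; by the epimorphism property it changes nothing on B either.
  let u : AddMonoid.End (Y × Y') := AddMonoidHom.mk' (fun p : Y × Y' => (p.1, p.2 + φ p.1))
    fun p p' => Prod.ext rfl (by simp only [Prod.snd_add, Prod.fst_add, map_add]; abel)
  let v : AddMonoid.End (Y × Y') := AddMonoidHom.mk' (fun p : Y × Y' => (p.1, p.2 - φ p.1))
    fun p p' => Prod.ext rfl (by simp only [Prod.snd_add, Prod.fst_add, map_add]; abel)
  have huv : u * v = 1 := DFunLike.ext _ _ fun p => Prod.ext rfl (sub_add_cancel p.2 (φ p.1))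
  have hvu : v * u = 1 := DFunLike.ext _ _ fun p => Prod.ext rfl (add_sub_cancel_right p.2 (φ p.1))
  let g₂ : Bᵐᵒᵖ →+* AddMonoid.End (Y × Y') :=
    { toFun := fun c => u * g₁ c * v
      map_one' := by rw [map_one, mul_one, huv]
      map_mul' := fun c d => by
        rw [map_mul]
        calc u * (g₁ c * g₁ d) * v = u * g₁ c * 1 * g₁ d * v := by simp only [mul_assoc, one_mul]
          _ = _ := by rw [← hvu]; simp only [mul_assoc]
      map_zero' := by rw [map_zero, mul_zero, zero_mul]
      map_add' := fun c d => by rw [map_add, mul_add, add_mul] }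
  let G (g : Bᵐᵒᵖ →+* AddMonoid.End (Y × Y')) : B →+* (AddMonoid.End (Y × Y'))ᵐᵒᵖ :=
    (RingHom.op g).comp (RingEquiv.opOp B).toRingHom
  have h : RingCat.ofHom f ≫ RingCat.ofHom (G g₁) = RingCat.ofHom f ≫ RingCat.ofHom (G g₂) := by
    ext a
    apply unop_injective
    change g₁ (op (f a)) = g₂ (op (f a))
    have hu : u * g₁ (op (f a)) = g₁ (op (f a)) * u := DFunLike.ext _ _ fun p => Prod.ext rfl (by
      change ρ' (op (f a)) p.2 + φ (ρ (op (f a)) p.1) = ρ' (op (f a)) (p.2 + φ p.1)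
      rw [hφ, map_add])
    change _ = u * g₁ (op (f a)) * v
    rw [hu, mul_assoc, huv, mul_one]
  have hE : Epi (RingCat.ofHom f) := hf
  have h' := congrArg RingCat.Hom.hom ((cancel_epi _).1 h)
  have h'' : g₁ (op b) = g₂ (op b) := congrArg unop (RingHom.congr_fun h' b)
  have h3 : ρ' (op b) 0 = ρ' (op b) (0 - φ y) + φ (ρ (op b) y) :=
    congrArg Prod.snd (DFunLike.congr_fun h'' (y, 0))
  rw [zero_sub, map_neg, map_zero] at h3
  exact (neg_add_eq_zero.1 h3.symm).symm

/-- Right multiplication by `y` on `B`, as an endomorphism of the left `A`-module `B`. -/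
def mulRightLeft (f : A →+* B) (y : B) : leftModule f →ₗ[A] leftModule f where
  toFun x := ((show B from x) * y : B)
  map_add' x x' := add_mul (show B from x) (show B from x') y
  map_smul' a x := mul_assoc (f a) (show B from x) y

/-- The element `x ⊗ y` of `B ⊗ B`. -/
abbrev btmul (f : A →+* B) (x y : B) : Tensor A (rightModule f) (leftModule f) :=
  tmul (M := rightModule f) (N := leftModule f) x y

/-- The map x ↦ x ⊗ 1 is right A-linear when B acts on the second factor of B ⊗ B, hence right
B-linear. -/
theorem IsRingEpi.tmul_eq (hf : IsRingEpi f) (x y : B) :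
    btmul f x y = btmul f 1 (x * y) := by
  let T := Tensor A (rightModule f) (leftModule f)
  let ρ' : Bᵐᵒᵖ →+* AddMonoid.End T :=
    { toFun := fun c => tensorMapRight _ (mulRightLeft f (unop c))
      map_one' := tensor_hom_ext fun m n => congrArg (btmul f m) (mul_one (show B from n))
      map_mul' := fun c d => tensor_hom_ext fun m n =>
        congrArg (btmul f m) (mul_assoc (show B from n) (unop d) (unop c)).symm
      map_zero' := tensor_hom_ext fun m n =>
        (congrArg (btmul f m) (mul_zero (show B from n))).trans (tmul_zero (N := leftModule f) m)
      map_add' := fun c d => tensor_hom_ext fun m n =>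
        (congrArg (btmul f m) (mul_add (show B from n) (unop c) (unop d))).trans
          (tmul_add (N := leftModule f) m _ _) }
  let φ : B →+ T := (tmulHom (rightModule f) (leftModule f)).flip (1 : B)
  have h (b y : B) : φ (y * b) = ρ' (op b) (φ y) :=
    hf.map_smul (Module.toAddMonoidEnd Bᵐᵒᵖ B) ρ' φ (fun a y => by
      refine (smul_tmul (A := A) (M := rightModule f) (N := leftModule f) y a (1 : B)).trans ?_
      refine congrArg (btmul f y) ?_
      change f a * 1 = 1 * f a
      rw [mul_one, one_mul]) b y
  have h1 : φ x = btmul f (1 : B) x := by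
    have := h x 1
    rw [one_mul] at this
    rw [this]
    exact congrArg (btmul f (1 : B)) (one_mul x)
  have h2 := congrArg (ρ' (op y)) h1
  rw [← h] at h2
  have h3 : φ (x * y) = btmul f (x : B) y := by
    rw [h]
    exact congrArg (btmul f x) (one_mul y)
  rw [← h3, h2]
  rfl

/-- If g and g' agree on A, then x ⊗ y ↦ g(x) g'(y) is well defined; compare its values at c ⊗ 1 and
1 ⊗ c. -/
theorem isRingEpi_of_tmul_comm (h : ∀ c : B,
    btmul f c 1 = btmul f 1 c) : IsRingEpi f := by
  refine ⟨fun {D} g g' hg => ?_⟩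
  ext c
  have hg' (a : A) : g.hom (f a) = g'.hom (f a) :=
    RingHom.congr_fun (congrArg RingCat.Hom.hom hg) a
  let φ : Tensor A (rightModule f) (leftModule f) →+ D := tensorLift
    (M := rightModule f) (N := leftModule f)
    (AddMonoidHom.mk' (fun x : B => (AddMonoidHom.mulLeft (g.hom x)).comp g'.hom.toAddMonoidHom)
      fun (x x' : B) => by
        ext y
        change g.hom (x + x') * g'.hom y = g.hom x * g'.hom y + g.hom x' * g'.hom y
        rw [map_add, add_mul])
    fun x a y => by
      change g.hom ((show B from x) * f a) * g'.hom y =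
        g.hom x * g'.hom (f a * (show B from y))
      rw [map_mul, map_mul, hg', mul_assoc]
  have h1 : g.hom c * g'.hom 1 = g.hom 1 * g'.hom c := congrArg φ (h c)
  rwa [map_one, map_one, mul_one, one_mul] at h1

theorem isRingEpi_of_surjective (hf : Function.Surjective f) : IsRingEpi f :=
  ConcreteCategory.epi_of_surjective (RingCat.ofHom f) hf

end EpiLemmas

/-! ### The presentation of B/f(A) and maps from its relations to B. -/

section Presentation

theorem exists_linearMap_comp_eq {R X Y Z : Type*} [Ring R] [AddCommGroup X] [Module R X]
    [AddCommGroup Y] [Module R Y] [AddCommGroup Z] [Module R Z] (p : X →ₗ[R] Y)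
    (hp : Function.Surjective p) (g : X →ₗ[R] Z) (h : ∀ x, p x = 0 → g x = 0) :
    ∃ g' : Y →ₗ[R] Z, ∀ x, g' (p x) = g x := by
  let e := p.quotKerEquivOfSurjective hp
  refine ⟨(LinearMap.ker p).liftQ g (fun x hx => h x hx) ∘ₗ e.symm.toLinearMap, fun x => ?_⟩
  have : e.symm (p x) = Submodule.Quotient.mk x := e.symm_apply_eq.2 rfl
  rw [LinearMap.comp_apply, LinearEquiv.coe_coe, this]
  rfl

instance free_regular_right (A : Type u) [Ring A] : Module.Free Aᵐᵒᵖ A :=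
  Module.Free.of_equiv (R := Aᵐᵒᵖ) (M := Aᵐᵒᵖ) (σ := RingHom.id _)
    { toFun := unop
      invFun := op
      map_add' := fun _ _ => rfl
      map_smul' := fun _ _ => rfl }

variable {A B : Type u} [Ring A] [Ring B] (f : A →+* B) {n : ℕ}

/-- The map `A ^ n → B`, `v ↦ ∑ i, β i * f (v i)`, of right `A`-modules. -/
def dot (β : Fin n → B) : (Fin n → A) →ₗ[Aᵐᵒᵖ] rightModule f where
  toFun v := (∑ i, β i * f (v i) : B)
  map_add' v w := by
    change (∑ i, β i * f (v i + w i) : B) = ∑ i, β i * f (v i) + ∑ i, β i * f (w i)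
    simp only [map_add, mul_add, Finset.sum_add_distrib]
  map_smul' c v := by
    change (∑ i, β i * f (v i * unop c) : B) = (∑ i, β i * f (v i)) * f (unop c)
    simp only [map_mul, Finset.sum_mul, mul_assoc]

theorem dot_apply (β : Fin n → B) (v : Fin n → A) :
    dot f β v = (∑ i, β i * f (v i) : B) := rfl

theorem dot_single (β : Fin n → B) (i : Fin n) (a : A) :
    dot f β (Pi.single i a) = (β i * f a : B) := by
  rw [dot_apply, Finset.sum_eq_single i]
  · rw [Pi.single_eq_same]
  · intro j _ hj
    rw [Pi.single_eq_of_ne hj, map_zero, mul_zero]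
  · simp

theorem eq_zero_of_dot_eq_zero (β : Fin n → B) (h : ∀ v, dot f β v = 0) : β = 0 := by
  funext i
  have := h (Pi.single i 1)
  rw [dot_single, map_one, mul_one] at this
  exact this

variable (b : Fin n → B)

/-- The map `A ^ n → B / f(A)` induced by `dot f b`. -/
def dotMk : (Fin n → A) →ₗ[Aᵐᵒᵖ] Coker f := (imageRight f).mkQ ∘ₗ dot f b

/-- The right `A`-module of all `v` in `A ^ n` with `∑ i, b i * f (v i)` in `f(A)`. -/
def relations : Submodule Aᵐᵒᵖ (Fin n → A) := (imageRight f).comap (dot f b)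

theorem dotMk_eq_zero_iff (v : Fin n → A) : dotMk f b v = 0 ↔ v ∈ relations f b :=
  Submodule.Quotient.mk_eq_zero _

variable {f b}

theorem exists_coef (v : relations f b) : ∃ a : A, f a = dot f b v := v.2

theorem dotMk_surjective (hb : Function.Surjective (dot f b)) : Function.Surjective (dotMk f b) :=
  (Submodule.mkQ_surjective _).comp hb

/-- `Hom_A(B / f(A), B) = 0`. -/
theorem eq_zero_of_dot_relations (hf : IsRingEpi f) (hb : Function.Surjective (dot f b))
    (β : Fin n → B) (h : ∀ v ∈ relations f b, dot f β v = 0) : β = 0 := by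
  -- The map given by β factors through a map φ : B → B. It kills 1, because 1 lies in f(A), and it
  -- is B-linear by the epimorphism property, so it is zero.
  obtain ⟨φ, hφ⟩ := exists_linearMap_comp_eq (dot f b) hb (dot f β) fun v hv =>
    h v ((dotMk_eq_zero_iff f b v).1 (by
      change (imageRight f).mkQ (dot f b v) = 0
      rw [hv, map_zero]))
  have hφ1 : φ (1 : B) = 0 := by
    obtain ⟨v, hv⟩ := hb (1 : B)
    rw [← hv, hφ]
    exact h v ⟨1, (map_one f).trans hv.symm⟩
  have hlin := hf.map_smul (Module.toAddMonoidEnd Bᵐᵒᵖ B) (Module.toAddMonoidEnd Bᵐᵒᵖ B)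
    φ.toAddMonoidHom (fun a y => φ.map_smul (op a) y)
  refine eq_zero_of_dot_eq_zero f β fun v => ?_
  rw [← hφ]
  have h1 : φ ((1 : B) * (show B from dot f b v) : B) =
      ((show B from φ (1 : B)) * (show B from dot f b v) : B) := hlin (dot f b v) (1 : B)
  rw [one_mul, hφ1] at h1
  exact h1.trans (zero_mul (show B from dot f b v))

/-- The inclusion of the relations into `A × A ^ n` whose cokernel is `B`. -/
theorem exists_resolution (hinj : Function.Injective f) (hb : Function.Surjective (dot f b)) :
    ∃ (κ : relations f b →ₗ[Aᵐᵒᵖ] A × (Fin n → A)) (q : A × (Fin n → A) →ₗ[Aᵐᵒᵖ] rightModule f),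
      (∀ v, f (κ v).1 = -∑ i, b i * f (v.1 i)) ∧ (∀ v, (κ v).2 = v) ∧
      (∀ x, q x = (f x.1 + (show B from dot f b x.2) : B)) ∧
      Function.Injective κ ∧ Function.Exact κ q ∧ Function.Surjective q := by
  choose c hc using exists_coef (f := f) (b := b)
  let κ : relations f b →ₗ[Aᵐᵒᵖ] A × (Fin n → A) :=
    { toFun := fun v => (-c v, v)
      map_add' := fun v w => Prod.ext (hinj (by
        simp only [Prod.fst_add, map_neg, map_add, hc, Submodule.coe_add]
        exact neg_add (show B from dot f b v) (show B from dot f b w))) rfl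
      map_smul' := fun a v => Prod.ext (hinj (by
        change f (-c (a • v)) = f (-c v * unop a)
        rw [map_mul, map_neg, map_neg, hc, hc, Submodule.coe_smul, map_smul]
        exact (neg_mul (show B from dot f b v) (f (unop a))).symm)) rfl }
  let q : A × (Fin n → A) →ₗ[Aᵐᵒᵖ] rightModule f :=
    { toFun := fun x => (f x.1 + (show B from dot f b x.2) : B)
      map_add' := fun x y => by
        change f (x.1 + y.1) + (show B from dot f b (x.2 + y.2)) =
          (f x.1 + (show B from dot f b x.2)) + (f y.1 + (show B from dot f b y.2))
        rw [map_add, map_add]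
        exact add_add_add_comm (f x.1) (f y.1) (show B from dot f b x.2) (show B from dot f b y.2)
      map_smul' := fun a x => by
        change f (x.1 * unop a) + (show B from dot f b (a • x.2)) =
          (f x.1 + (show B from dot f b x.2)) * f (unop a)
        rw [map_mul, map_smul]
        exact (add_mul (f x.1) (show B from dot f b x.2) (f (unop a))).symm }
  have hκ (v) : f (κ v).1 = (-(show B from dot f b v) : B) := by
    change f (-c v) = _
    rw [map_neg, hc]
  refine ⟨κ, q, hκ, fun v => rfl, fun x => rfl, fun v w h => Subtype.ext (congrArg Prod.snd h),
    fun x => ⟨fun h => ?_, ?_⟩, fun y => ?_⟩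
  · have h' : (f x.1 + (show B from dot f b x.2) : B) = 0 := h
    refine ⟨⟨x.2, -x.1, ?_⟩, Prod.ext (hinj ?_) rfl⟩
    · rw [map_neg]
      exact neg_eq_of_add_eq_zero_right h'
    · rw [hκ]
      exact (eq_neg_of_add_eq_zero_left h').symm
  · rintro ⟨v, rfl⟩
    change f (κ v).1 + (show B from dot f b v) = 0
    rw [hκ]
    exact neg_add_cancel (show B from dot f b v)
  · obtain ⟨v, rfl⟩ := hb y
    refine ⟨(0, v), ?_⟩
    change f 0 + (show B from dot f b v) = _
    rw [map_zero]
    exact zero_add (show B from dot f b v)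

/-- The additive map `A ^ n ⊗ B → B ^ n`, `v ⊗ y ↦ (f (v i) * y)`. -/
def tensorCoords (f : A →+* B) (n : ℕ) :
    Tensor A (Fin n → A) (leftModule f) →+ (Fin n → B) :=
  tensorLift (N := leftModule f) (AddMonoidHom.mk' (fun v => AddMonoidHom.mk'
    (fun y : B => fun i => f (v i) * y) fun y y' => funext fun i => mul_add (f (v i)) y y')
    fun v w => AddMonoidHom.ext fun y : B => funext fun i => by
      change f (v i + w i) * y = f (v i) * y + f (w i) * y
      rw [map_add, add_mul]) fun v a y => funext fun i => by
        change f (v i * a) * (show B from y) = f (v i) * (f a * (show B from y))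
        rw [map_mul, mul_assoc]

theorem tensorCoords_tmul (v : Fin n → A) (y : B) (i : Fin n) :
    tensorCoords f n (tmul (N := leftModule f) v y) i = f (v i) * y := rfl

/-- `B / f(A) ⊗ B = 0`. -/
theorem coker_tmul_eq_zero (hf : IsRingEpi f) (x y : B) :
    tmul (A := A) (N := leftModule f) ((imageRight f).mkQ x) y = 0 := by
  have h := congrArg (tensorMap (leftModule f) (imageRight f).mkQ) (hf.tmul_eq x y)
  refine h.trans ?_
  change tmul (A := A) (N := leftModule f) ((imageRight f).mkQ (1 : B)) (x * y : B) = 0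
  have h1 : (imageRight f).mkQ (1 : B) = 0 :=
    (Submodule.Quotient.mk_eq_zero _).2 ⟨1, map_one f⟩
  rw [h1]
  exact zero_tmul (N := leftModule f) (x * y : B)

/-- K ⊗ B ≅ B^n. Injectivity comes from Tor_1(B, B) = 0, surjectivity from (B/f(A)) ⊗ B = 0. -/
theorem tensorCoords_relations_bijective (hinj : Function.Injective f) (hf : IsRingEpi f)
    (hb : Function.Surjective (dot f b))
    (htor : Limits.IsZero (Tor 1 (rightModule f) (leftModule f))) :
    Function.Bijective ((tensorCoords f n).comp
      (tensorMap (leftModule f) (relations f b).subtype)) := by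
  constructor
  · obtain ⟨κ, q, hκ1, hκ2, hq, hκ, hκq, hqs⟩ := exists_resolution hinj hb
    have hκN := tensorMap_injective_of_isZero_tor_one (rightModule f) (leftModule f) htor hκ hκq hqs
    let t : A × (Fin n → A) →+ B →+ Tensor A (A × (Fin n → A)) (leftModule f) :=
      tmulHom (A × (Fin n → A)) (leftModule f)
    have ht (x) (a : A) (y : B) : t x (f a * y) = t (op a • x) y :=
      (smul_tmul (N := leftModule f) x a y).symm
    let θ := (tensorCoords f n).comp (tensorMap (leftModule f) (relations f b).subtype)
    -- Vanishing of Tor only gives injectivity into (A × A^n) ⊗ B; this formula shows that the B^n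
    -- coordinates determine the remaining one.
    have key (z : Tensor A (relations f b) (leftModule f)) : tensorMap (leftModule f) κ z =
        t (1, 0) (-∑ i, b i * θ z i) + ∑ i, t (0, Pi.single i 1) (θ z i) := by
      induction z using tensor_induction with
      | h0 => simp
      | ht v y =>
        suffices H : ∀ y : B, t (κ v) y = t (1, 0) (-∑ i, b i * (f (v.1 i) * y)) +
          ∑ i, t (0, Pi.single i 1) (f (v.1 i) * y) from H y
        intro y
        have hsum : -∑ i, b i * (f (v.1 i) * y) = f (κ v).1 * y := by
          simp only [← mul_assoc]
          rw [hκ1, ← Finset.sum_mul, ← neg_mul]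
        rw [hsum]
        simp only [ht]
        rw [← AddMonoidHom.finsetSum_apply, ← map_sum, ← AddMonoidHom.add_apply, ← map_add]
        congr 2
        ext i
        · simp [Prod.fst_sum]
        · simp [Prod.snd_sum, hκ2, Pi.single_apply]
      | ha x y hx hy =>
        simp only [map_add, hx, hy, Pi.add_apply, mul_add, Finset.sum_add_distrib, neg_add]
        abel
    refine (injective_iff_map_eq_zero _).2 fun z hz => hκN ?_
    change θ z = 0 at hz
    rw [key, hz, map_zero]
    simp
  · intro w
    have hex := tensorMap_exact (N := leftModule f) (relations f b).subtype (dotMk f b)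
      (fun v => (dotMk_eq_zero_iff f b v).trans ⟨fun h => ⟨⟨v, h⟩, rfl⟩, fun ⟨v', h⟩ => h ▸ v'.2⟩)
      (dotMk_surjective hb)
    obtain ⟨z, hz⟩ := (hex (∑ i, tmul (A := A) (N := leftModule f)
      (Pi.single i 1 : Fin n → A) (w i))).1 (by
        rw [map_sum]
        refine Finset.sum_eq_zero fun i _ => ?_
        exact coker_tmul_eq_zero hf (show B from dot f b (Pi.single i 1)) (w i))
    refine ⟨z, ?_⟩
    rw [AddMonoidHom.comp_apply, hz, map_sum]
    funext j
    rw [Finset.sum_apply, Finset.sum_eq_single j]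
    · rw [tensorCoords_tmul, Pi.single_eq_same, map_one, one_mul]
    · intro i _ hi
      rw [tensorCoords_tmul, Pi.single_eq_of_ne hi.symm, map_zero, zero_mul]
    · simp

/-- `Ext_A^1(B / f(A), B) = 0`: every map from the relations to `B` extends to `A ^ n`. -/
theorem exists_extension (hinj : Function.Injective f) (hf : IsRingEpi f)
    (hb : Function.Surjective (dot f b))
    (htor : Limits.IsZero (Tor 1 (rightModule f) (leftModule f)))
    (g : relations f b →ₗ[Aᵐᵒᵖ] rightModule f) :
    ∃ β : Fin n → B, ∀ v : relations f b, dot f β v = g v := by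
  let θ := AddEquiv.ofBijective _ (tensorCoords_relations_bijective hinj hf hb htor)
  let G : Tensor A (relations f b) (leftModule f) →+ B :=
    tensorLift (N := leftModule f) (AddMonoidHom.mk' (fun v => AddMonoidHom.mulLeft
      (show B from g v)) fun v w => AddMonoidHom.ext fun y : B => by
        change (show B from g (v + w)) * y = (show B from g v) * y + (show B from g w) * y
        rw [map_add]
        exact add_mul (show B from g v) (show B from g w) y) fun v a y => by
          change (show B from g (op a • v)) * (show B from y) =
            (show B from g v) * (f a * (show B from y))
          rw [map_smul, ← mul_assoc]
          rfl
  let R (y : B) : Tensor A (relations f b) (leftModule f) →+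
    Tensor A (relations f b) (leftModule f) := tensorMapRight _ (mulRightLeft f y)
  have hG (y : B) (z) : G (R y z) = G z * y := by
    induction z using tensor_induction with
    | h0 => rw [map_zero, map_zero, zero_mul]
    | ht v x => exact (mul_assoc (show B from g v) (show B from x) y).symm
    | ha z z' h h' => rw [map_add, map_add, h, h', map_add, add_mul]
  have hθ (y : B) (z) (i : Fin n) : θ (R y z) i = θ z i * y := by
    induction z using tensor_induction with
    | h0 => rw [map_zero, map_zero, Pi.zero_apply, zero_mul]
    | ht v x => exact (mul_assoc (f (v.1 i)) (show B from x) y).symm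
    | ha z z' h h' =>
      rw [map_add, map_add, Pi.add_apply, h, h', map_add, Pi.add_apply, add_mul]
  -- The map B^n → B adjoint to `g` is right B-linear, so it is determined by its values at the
  -- standard basis, which are the entries of β.
  have hs (i : Fin n) (y : B) :
      G (θ.symm (Pi.single i y)) = G (θ.symm (Pi.single i 1)) * y := by
    rw [← hG]
    congr 1
    rw [θ.symm_apply_eq]
    funext j
    rw [hθ, θ.apply_symm_apply]
    by_cases h : j = i
    · subst h; simp
    · simp [h]
  refine ⟨fun i => G (θ.symm (Pi.single i 1)), fun v => ?_⟩
  have h1 : θ (tmul (N := leftModule f) v (1 : B)) = ∑ i, Pi.single i (f (v.1 i)) := by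
    funext i
    rw [Finset.univ_sum_single]
    exact mul_one (f (v.1 i))
  have h2 : G (tmul (N := leftModule f) v (1 : B)) = g v := mul_one (show B from g v)
  rw [← h2, ← θ.symm_apply_apply (tmul (N := leftModule f) v (1 : B)), h1, map_sum, map_sum]
  rw [dot_apply]
  exact Finset.sum_congr rfl fun i _ => (hs i _).symm

end Presentation

/-! ### The dual of the relations, realised inside B^n. -/

section Dual

variable {A B : Type u} [Ring A] [Ring B] (f : A →+* B) {n : ℕ}

/-- The value `∑ i, β i * f (v i)` of `dot f β` at `v`, as an element of `B`. -/
def dotB (β : Fin n → B) (v : Fin n → A) : B := ∑ i, β i * f (v i)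

theorem dot_eq_dotB (β : Fin n → B) (v : Fin n → A) : dot f β v = dotB f β v := rfl

theorem dotB_add (β β' : Fin n → B) (v : Fin n → A) :
    dotB f (β + β') v = dotB f β v + dotB f β' v := by
  simp only [dotB, Pi.add_apply, add_mul, Finset.sum_add_distrib]

theorem dotB_mul_left (y : B) (β : Fin n → B) (v : Fin n → A) :
    dotB f (fun i => y * β i) v = y * dotB f β v := by
  simp only [dotB, Finset.mul_sum, mul_assoc]

theorem dotB_add_right (β : Fin n → B) (v w : Fin n → A) :
    dotB f β (v + w) = dotB f β v + dotB f β w :=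
  map_add (dot f β) v w

theorem dotB_smul_right (β : Fin n → B) (a : A) (v : Fin n → A) :
    dotB f β (op a • v) = dotB f β v * f a :=
  map_smul (dot f β) (op a) v

variable (b : Fin n → B)

/-- The left `A`-module of all `β` in `B ^ n` that map the relations of `b` to `f(A)`. -/
def dual : Submodule A (Fin n → leftModule f) where
  carrier := {β | ∀ v ∈ relations f b, ∃ a, f a = dotB f (fun i => (β i : B)) v}
  add_mem' {β β'} h h' v hv := by
    obtain ⟨a, ha⟩ := h v hv
    obtain ⟨a', ha'⟩ := h' v hv
    refine ⟨a + a', ?_⟩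
    rw [map_add, ha, ha']
    exact (dotB_add f (fun i => (β i : B)) (fun i => (β' i : B)) v).symm
  zero_mem' v hv := ⟨0, by
    rw [map_zero]
    exact (Finset.sum_eq_zero fun i _ => zero_mul (f (v i))).symm⟩
  smul_mem' c β h v hv := by
    obtain ⟨a, ha⟩ := h v hv
    refine ⟨c * a, ?_⟩
    rw [map_mul, ha]
    exact (dotB_mul_left f (f c) (fun i => (β i : B)) v).symm

variable {f b}

/-- The underlying vector of an element of `dual f b`. -/
def vec : dual f b →+ (Fin n → B) := (dual f b).subtype.toAddMonoidHom

theorem vec_injective : Function.Injective (vec (f := f) (b := b)) := Subtype.val_injective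

theorem vec_smul (a : A) (β : dual f b) : vec (a • β) = fun i => f a * vec β i := rfl

/-- The element `a` of `A` with `f a = ∑ i, β i * f (v i)`. -/
def coef (β : dual f b) (v : relations f b) : A := (β.2 v.1 v.2).choose

theorem map_coef (β : dual f b) (v : relations f b) : f (coef β v) = dotB f (vec β) v :=
  (β.2 v.1 v.2).choose_spec

/-- Evaluation at a relation, as a map of left `A`-modules. -/
def evalDual (hinj : Function.Injective f) (v : relations f b) : dual f b →ₗ[A] A where
  toFun β := coef β v
  map_add' β β' := hinj (by rw [map_add, map_coef, map_coef, map_coef, map_add, dotB_add])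
  map_smul' a β := hinj (by
    rw [RingHom.id_apply, smul_eq_mul, map_mul, map_coef, map_coef, vec_smul, dotB_mul_left])

/-- An element of `dual f b`, as a map from the relations to `A`. -/
def dualHom (hinj : Function.Injective f) (β : dual f b) : relations f b →ₗ[Aᵐᵒᵖ] A where
  toFun v := coef β v
  map_add' v w := hinj (by
    rw [map_add, map_coef, map_coef, map_coef, Submodule.coe_add, dotB_add_right])
  map_smul' a v := hinj (by
    change f (coef β (op (unop a) • v)) = f (coef β v * unop a)
    rw [map_mul, map_coef, map_coef, Submodule.coe_smul, dotB_smul_right])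

/-- The member of `dual f b` given by a vector `β`. -/
def mkDual (β : Fin n → B) (h : ∀ v ∈ relations f b, ∃ a, f a = dotB f β v) : dual f b := ⟨β, h⟩

theorem vec_mkDual (β : Fin n → B) (h : ∀ v ∈ relations f b, ∃ a, f a = dotB f β v) :
    vec (mkDual β h) = β := rfl

/-- Restriction to K loses no information, because Hom_A(B/f(A), B) = 0. -/
theorem dual_ext (hf : IsRingEpi f) (hb : Function.Surjective (dot f b)) {β β' : dual f b}
    (h : ∀ v, coef β v = coef β' v) : β = β' := by
  rw [← sub_eq_zero]
  apply vec_injective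
  rw [map_zero]
  refine eq_zero_of_dot_relations hf hb _ fun v hv => ?_
  rw [dot_eq_dotB]
  have h1 := dotB_add f (vec (β - β')) (vec β') v
  rw [← map_add, sub_add_cancel, ← map_coef β ⟨v, hv⟩, h, map_coef β' ⟨v, hv⟩] at h1
  exact (add_eq_right.1 h1.symm)

/-- The map `M ⊗ dual f b → M` induced by evaluation at a relation. -/
def tensorEval (M : Type u) [AddCommGroup M] [Module Aᵐᵒᵖ M] (hinj : Function.Injective f)
    (v : relations f b) : Tensor A M (dual f b) →+ M :=
  tensorLift (AddMonoidHom.mk' (fun m => AddMonoidHom.mk' (fun β => op (evalDual hinj v β) • m)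
    fun β β' => by rw [map_add, MulOpposite.op_add, add_smul])
    fun m m' => AddMonoidHom.ext fun β => smul_add _ m m') fun m a β => by
      change op (evalDual hinj v β) • op a • m = op (evalDual hinj v (a • β)) • m
      rw [map_smul, smul_eq_mul, op_mul, mul_smul]

theorem tensorEval_tmul {M : Type u} [AddCommGroup M] [Module Aᵐᵒᵖ M]
    (hinj : Function.Injective f) (v : relations f b) (m : M) (β : dual f b) :
    tensorEval M hinj v (tmul m β) = op (coef β v) • m := rfl

variable (hinj : Function.Injective f) (hf : IsRingEpi f) (hb : Function.Surjective (dot f b))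
  (htor : Limits.IsZero (Tor 1 (rightModule f) (leftModule f)))

include hinj hf hb htor

/-- Every map from the relations to `A` comes from `dual f b`. -/
theorem exists_dual_coef (g : relations f b →ₗ[Aᵐᵒᵖ] A) :
    ∃ β : dual f b, ∀ v, coef β v = g v := by
  let g' : relations f b →ₗ[Aᵐᵒᵖ] rightModule f :=
    { toFun := fun v => f (g v)
      map_add' := fun v w => by rw [map_add, map_add]; rfl
      map_smul' := fun a v => by
        rw [map_smul]
        exact map_mul f (g v) (unop a) }
  obtain ⟨β, hβ⟩ := exists_extension hinj hf hb htor g'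
  have hβ' (v : relations f b) : dotB f β v = f (g v) := hβ v
  refine ⟨mkDual β fun v hv => ⟨g ⟨v, hv⟩, (hβ' ⟨v, hv⟩).symm⟩, fun v => hinj ?_⟩
  rw [map_coef, vec_mkDual, hβ']

/-- K is a direct summand of some A^m. The `l j` are the images of the standard basis and the `h j`
represent the coordinate functions. -/
theorem exists_dual_basis [Module.Finite Aᵐᵒᵖ (relations f b)]
    [Module.Projective Aᵐᵒᵖ (relations f b)] :
    ∃ (m : ℕ) (l : Fin m → relations f b) (h : Fin m → dual f b),
      ∀ β, β = ∑ j, coef β (l j) • h j := by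
  obtain ⟨m, p, s, -, -, hps⟩ :=
    Module.Finite.exists_comp_eq_id_of_projective Aᵐᵒᵖ (relations f b)
  let g (j : Fin m) : relations f b →ₗ[Aᵐᵒᵖ] A :=
    { toFun := fun v => unop (s v j)
      map_add' := fun v w => by rw [map_add]; rfl
      map_smul' := fun a v => by rw [map_smul]; rfl }
  choose h hh using fun j => exists_dual_coef hinj hf hb htor (g j)
  refine ⟨m, fun j => p (Pi.single j 1), h, fun β => dual_ext hf hb fun v => ?_⟩
  have hv : v = ∑ j, s v j • p (Pi.single j 1) := by
    conv_lhs => rw [← LinearMap.id_apply (R := Aᵐᵒᵖ) v, ← hps, LinearMap.comp_apply,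
      pi_eq_sum_univ' (s v), map_sum]
    refine Finset.sum_congr rfl fun j _ => ?_
    rw [map_smul]
  change dualHom hinj β v = evalDual hinj v _
  conv_lhs => rw [hv, map_sum]
  rw [map_sum]
  refine Finset.sum_congr rfl fun j _ => ?_
  rw [map_smul, map_smul]
  change _ = _ * coef (h j) v
  rw [hh]
  rfl

theorem projective_dual [Module.Finite Aᵐᵒᵖ (relations f b)]
    [Module.Projective Aᵐᵒᵖ (relations f b)] : Module.Projective A (dual f b) := by
  obtain ⟨m, l, h, hl⟩ := exists_dual_basis hinj hf hb htor
  refine Module.Projective.of_split (P := dual f b) (M := Fin m → A)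
    (LinearMap.pi fun j => evalDual hinj (l j)) (Fintype.linearCombination A h) ?_
  ext1 β
  exact (hl β).symm

/-- `M ⊗ dual f b` embeds into the group of maps from the relations to `M`. -/
theorem tensor_dual_eq_zero [Module.Finite Aᵐᵒᵖ (relations f b)]
    [Module.Projective Aᵐᵒᵖ (relations f b)] {M : Type u} [AddCommGroup M] [Module Aᵐᵒᵖ M]
    (z : Tensor A M (dual f b)) (hz : ∀ v, tensorEval M hinj v z = 0) : z = 0 := by
  obtain ⟨m, l, h, hl⟩ := exists_dual_basis hinj hf hb htor
  have key : z = ∑ j, tmul (tensorEval M hinj (l j) z) (h j) := by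
    clear hz
    induction z using tensor_induction with
    | h0 => simp [zero_tmul]
    | ht m β =>
      conv_lhs => rw [hl β, tmul_sum]
      simp only [tensorEval_tmul, smul_tmul]
    | ha x y hx hy =>
      conv_lhs => rw [hx, hy, ← Finset.sum_add_distrib]
      simp only [map_add, add_tmul]
  rw [key]
  exact Finset.sum_eq_zero fun j _ => by rw [hz, zero_tmul]

end Dual

/-! ### The resolution 0 → A^n → K* → C → 0 and the homological epimorphism μ. -/

section EndCokerLemmas

variable {A B : Type u} [Ring A] [Ring B] (f : A →+* B) {n : ℕ}

/-- The projection `B → B / f(A)`. -/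
def cmk : B →+ Coker f := (imageRight f).mkQ.toAddMonoidHom

theorem cmk_surjective : Function.Surjective (cmk f) :=
  Submodule.mkQ_surjective (imageRight f)

theorem cmk_eq_zero_iff (y : B) : cmk f y = 0 ↔ ∃ a, f a = y :=
  Submodule.Quotient.mk_eq_zero _

theorem smul_cmk (a : A) (y : B) : op a • cmk f y = cmk f (y * f a) := rfl

theorem mu_cmk (a : A) (y : B) : mu f a (cmk f y) = cmk f (f a * y) := rfl

theorem mu_eq_zero_iff (a : A) : mu f a = 0 ↔ ∀ y, ∃ a', f a' = f a * y := by
  constructor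
  · intro h y
    rw [← cmk_eq_zero_iff, ← mu_cmk, h, LinearMap.zero_apply]
  · intro h
    refine LinearMap.ext fun x => ?_
    obtain ⟨y, rfl⟩ := cmk_surjective f x
    rw [mu_cmk, LinearMap.zero_apply, cmk_eq_zero_iff]
    exact h y

theorem dotB_single (β : Fin n → B) (i : Fin n) (a : A) :
    dotB f β (Pi.single i a) = β i * f a := dot_single f β i a

variable {f} {b : Fin n → B}

/-- The endomorphism of `B / f(A)` induced by an element of `dual f b`. -/
def dualToEndAux (hb : Function.Surjective (dot f b)) (β : dual f b) : EndCoker f :=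
  (exists_linearMap_comp_eq (dotMk f b) (dotMk_surjective hb)
    ((imageRight f).mkQ ∘ₗ dot f (vec β)) fun v hv => by
      refine (cmk_eq_zero_iff f _).2 ?_
      exact ⟨coef β ⟨v, (dotMk_eq_zero_iff f b v).1 hv⟩, map_coef β _⟩).choose

theorem dualToEndAux_dotMk (hb : Function.Surjective (dot f b)) (β : dual f b) (w : Fin n → A) :
    dualToEndAux hb β (dotMk f b w) = cmk f (dotB f (vec β) w) :=
  Exists.choose_spec (p := fun g : EndCoker f => ∀ x, g (dotMk f b x) =
    ((imageRight f).mkQ ∘ₗ dot f (vec β)) x) _ w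

theorem endCoker_ext (hb : Function.Surjective (dot f b)) {c c' : EndCoker f}
    (h : ∀ w, c (dotMk f b w) = c' (dotMk f b w)) : c = c' := by
  refine LinearMap.ext fun x => ?_
  obtain ⟨w, rfl⟩ := dotMk_surjective hb x
  exact h w

/-- The map `dual f b → End_A(B / f(A))` of left `A`-modules. -/
def dualToEnd (hb : Function.Surjective (dot f b)) : dual f b →ₗ[A] leftModule (mu f) where
  toFun β := dualToEndAux hb β
  map_add' β β' := endCoker_ext hb fun w => by
    change _ = dualToEndAux hb β (dotMk f b w) + dualToEndAux hb β' (dotMk f b w)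
    rw [dualToEndAux_dotMk, dualToEndAux_dotMk, dualToEndAux_dotMk, map_add, dotB_add, map_add]
  map_smul' a β := endCoker_ext hb fun w => by
    change _ = mu f a (dualToEndAux hb β (dotMk f b w))
    rw [dualToEndAux_dotMk, dualToEndAux_dotMk, mu_cmk, vec_smul, dotB_mul_left]

/-- The inclusion `A ^ n → dual f b`. -/
def inclDual (b : Fin n → B) : (Fin n → A) →ₗ[A] dual f b where
  toFun α := mkDual (fun i => f (α i)) fun v _ => ⟨∑ i, α i * v i, by
    simp only [dotB, map_sum, map_mul]⟩
  map_add' α α' := vec_injective (funext fun i => map_add f (α i) (α' i))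
  map_smul' a α := vec_injective (funext fun i => map_mul f a (α i))

theorem vec_inclDual (α : Fin n → A) (i : Fin n) : vec (inclDual (f := f) b α) i = f (α i) := rfl

theorem inclDual_injective (hinj : Function.Injective f) :
    Function.Injective (inclDual (f := f) b) := fun _ _ h =>
  funext fun i => hinj (congrFun (congrArg vec h) i)

theorem coef_inclDual (hinj : Function.Injective f) (α : Fin n → A) (v : relations f b) :
    coef (inclDual b α) v = ∑ i, α i * v.1 i := by
  apply hinj
  rw [map_coef, dotB, map_sum]
  simp only [vec_inclDual, map_mul]

theorem exact_inclDual_dualToEnd (hb : Function.Surjective (dot f b)) :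
    Function.Exact (inclDual b) (dualToEnd hb) := by
  intro β
  have h1 : dualToEnd hb β = 0 ↔ ∀ w, cmk f (dotB f (vec β) w) = 0 := by
    constructor
    · intro h w
      have h' : dualToEndAux hb β = 0 := h
      rw [← dualToEndAux_dotMk hb, h', LinearMap.zero_apply]
    · intro h
      refine endCoker_ext hb fun w => (dualToEndAux_dotMk hb β w).trans (h w)
  rw [h1]
  constructor
  · intro h
    have h' (i : Fin n) : ∃ a, f a = vec β i := by
      rw [← cmk_eq_zero_iff, ← h (Pi.single i 1), dotB_single, map_one, mul_one]
    choose α hα using h'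
    exact ⟨α, vec_injective (funext hα)⟩
  · rintro ⟨α, rfl⟩ w
    rw [cmk_eq_zero_iff]
    refine ⟨∑ i, α i * w i, ?_⟩
    simp only [dotB, map_sum, map_mul, vec_inclDual]

/-- An endomorphism of B/f(A) lifts along B → B/f(A) on the free module A^n; the lift sends K into
f(A) because the endomorphism is well defined on the quotient. -/
theorem dualToEnd_surjective (hb : Function.Surjective (dot f b)) :
    Function.Surjective (dualToEnd hb) := by
  suffices H : ∀ c : EndCoker f, ∃ β, dualToEndAux hb β = c from H
  intro c
  choose β hβ using fun i : Fin n => cmk_surjective f (c (dotMk f b (Pi.single i 1)))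
  have hw (w : Fin n → A) : cmk f (dotB f β w) = c (dotMk f b w) := by
    have hw : w = ∑ i, op (w i) • (Pi.single i 1 : Fin n → A) := by
      ext i
      simp [Finset.sum_apply, Pi.single_apply]
    conv_rhs => rw [hw]
    rw [map_sum, map_sum, dotB, map_sum]
    refine Finset.sum_congr rfl fun i _ => ?_
    rw [map_smul, map_smul, ← hβ, smul_cmk]
  refine ⟨mkDual β fun v hv => ?_, endCoker_ext hb fun w => ?_⟩
  · rw [← cmk_eq_zero_iff, hw, (dotMk_eq_zero_iff f b v).2 hv, map_zero]
  · rw [dualToEndAux_dotMk, vec_mkDual, hw]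

/-- The family `b` itself as an element of `dual f b`. -/
def selfDual (f : A →+* B) (b : Fin n → B) : dual f b := mkDual b fun _ hv => hv

theorem dualToEndAux_selfDual (hb : Function.Surjective (dot f b)) :
    dualToEndAux hb (selfDual f b) = 1 :=
  endCoker_ext hb fun w => dualToEndAux_dotMk hb _ w

variable (hinj : Function.Injective f) (hf : IsRingEpi f) (hb : Function.Surjective (dot f b))

include hf in
/-- `Hom_A(B / f(A), End_A(B / f(A))) = 0`. -/
theorem linearMap_eq_zero_of_map_one (g : rightModule f →ₗ[Aᵐᵒᵖ] rightModule (mu f))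
    (h1 : g (1 : B) = 0) : g = 0 := by
  -- By adjunction `g` becomes x ⊗ y ↦ g(x)(y + f(A)); now x ⊗ y = 1 ⊗ xy reduces everything to
  -- g(1).
  let φ : Tensor A (rightModule f) (leftModule f) →+ Coker f :=
    tensorLift (M := rightModule f) (N := leftModule f)
      (AddMonoidHom.mk' (fun x => (show EndCoker f from g x).toAddMonoidHom.comp (cmk f))
        fun x x' => by
          rw [map_add]
          rfl) fun x a y => by
        change (show EndCoker f from g (op a • x)) (cmk f y) =
          (show EndCoker f from g x) (mu f a (cmk f y))
        rw [map_smul]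
        rfl
  refine LinearMap.ext fun x => ?_
  suffices H : (show EndCoker f from g x) = 0 from H
  refine LinearMap.ext fun s => ?_
  obtain ⟨y, rfl⟩ := cmk_surjective f s
  have h2 : (show EndCoker f from g x) (cmk f y) =
      (show EndCoker f from g (1 : B)) (cmk f ((show B from x) * y)) :=
    congrArg φ (hf.tmul_eq x y)
  rw [h2, h1]
  rfl

-- Under C ⊗ A^n = Hom(A^n, C), an element of the kernel is a map vanishing on K. It therefore
-- factors through B and kills 1, so it is zero.
include hinj hf hb in
theorem tensorMapRight_inclDual_injective :
    Function.Injective (tensorMapRight (rightModule (mu f)) (inclDual (f := f) b)) := by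
  refine (injective_iff_map_eq_zero _).2 fun z hz => ?_
  obtain ⟨c, rfl⟩ : ∃ c : Fin n → rightModule (mu f),
      z = ∑ i, tmul (c i) (Pi.single i 1 : Fin n → A) := by
    clear hz
    induction z using tensor_induction with
    | h0 => exact ⟨0, by simp [zero_tmul]⟩
    | ht m α =>
      refine ⟨fun i => op (α i) • m, ?_⟩
      simp only [smul_tmul, ← tmul_sum]
      congr 1
      ext i
      simp [Finset.sum_apply, Pi.single_apply]
    | ha x y hx hy =>
      obtain ⟨c, rfl⟩ := hx
      obtain ⟨d, rfl⟩ := hy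
      exact ⟨c + d, by simp only [Pi.add_apply, add_tmul, Finset.sum_add_distrib]⟩
  let γ : (Fin n → A) →ₗ[Aᵐᵒᵖ] rightModule (mu f) :=
    { toFun := fun w => ∑ i, op (w i) • c i
      map_add' := fun v w => by
        simp only [Pi.add_apply, MulOpposite.op_add, add_smul, Finset.sum_add_distrib]
      map_smul' := fun a w => by
        simp only [Pi.smul_apply, Finset.smul_sum, smul_smul, RingHom.id_apply]
        rfl }
  have hγ (v : Fin n → A) (hv : v ∈ relations f b) : γ v = 0 := by
    have h := congrArg (tensorEval (rightModule (mu f)) hinj ⟨v, hv⟩) hz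
    rw [map_zero, map_sum, map_sum] at h
    rw [← h]
    change ∑ i, op (v i) • c i = _
    refine Finset.sum_congr rfl fun i _ => ?_
    have hvi : ∑ j, (Pi.single i 1 : Fin n → A) j * v j = v i := by simp [Pi.single_apply]
    rw [tensorMapRight_tmul, tensorEval_tmul, coef_inclDual hinj, hvi]
  obtain ⟨g, hg⟩ := exists_linearMap_comp_eq (dot f b) hb γ fun v hv => hγ v (by
    rw [← dotMk_eq_zero_iff]
    change (imageRight f).mkQ (dot f b v) = 0
    rw [hv, map_zero])
  have hg0 : g = 0 := linearMap_eq_zero_of_map_one hf g (by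
    obtain ⟨v, hv⟩ := hb (1 : B)
    rw [← hv, hg]
    exact hγ v ⟨1, (map_one f).trans hv.symm⟩)
  refine Finset.sum_eq_zero fun i _ => ?_
  have hci : c i = γ (Pi.single i 1) := by
    change _ = ∑ j, op ((Pi.single i 1 : Fin n → A) j) • c j
    rw [Finset.sum_eq_single i]
    · simp
    · intro j _ hj
      simp [hj]
    · simp
  rw [hci, ← hg, hg0, LinearMap.zero_apply, zero_tmul]

variable (htor : Limits.IsZero (Tor 1 (rightModule f) (leftModule f)))
  [Module.Finite Aᵐᵒᵖ (relations f b)] [Module.Projective Aᵐᵒᵖ (relations f b)]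

include hinj hf hb htor in
theorem isRingEpi_mu : IsRingEpi (mu f) := by
  refine isRingEpi_of_tmul_comm fun c => ?_
  obtain ⟨β, hβ⟩ := dualToEnd_surjective hb c
  have hβ' (w) : c (cmk f (dotB f b w)) = cmk f (dotB f (vec β) w) := by
    rw [← dualToEndAux_dotMk hb]
    exact (DFunLike.congr_fun (F := EndCoker f) hβ _).symm
  -- `d i` measures how far `c` is from commuting with the lift β on the i-th generator. It is well
  -- defined on B/f(A) because both terms agree on f(A).
  let d (i : Fin n) : EndCoker f := (imageRight f).liftQ
    { toFun := fun y : B => cmk f (vec β i * y) - c (cmk f (b i * y))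
      map_add' := fun (y y' : B) => by
        change cmk f (vec β i * (y + y')) - c (cmk f (b i * (y + y'))) = _
        simp only [mul_add, map_add]
        abel
      map_smul' := fun a (y : B) => by
        change cmk f (vec β i * (y * f (unop a))) - c (cmk f (b i * (y * f (unop a)))) =
          op (unop a) • (cmk f (vec β i * y) - c (cmk f (b i * y)))
        rw [smul_sub, ← map_smul c, smul_cmk, smul_cmk, mul_assoc, mul_assoc] } (by
      rintro _ ⟨a, rfl⟩
      change cmk f (vec β i * f a) - c (cmk f (b i * f a)) = 0
      rw [← dotB_single, ← dotB_single, hβ', sub_self])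
  have hd (i : Fin n) (y : B) : d i (cmk f y) = cmk f (vec β i * y) - c (cmk f (b i * y)) := rfl
  let t : EndCoker f →+ dual f b →+ Tensor A (rightModule (mu f)) (dual f b) :=
    tmulHom (rightModule (mu f)) (dual f b)
  -- As maps K → C, the first two terms differ by the restriction of the map A^n → C with components
  -- `d i`. Passing to C ⊗ C kills that restriction and leaves 1 ⊗ c = c ⊗ 1.
  have hz : t 1 β - t c (selfDual f b) - ∑ i, t (d i) (inclDual b (Pi.single i 1)) = 0 := by
    refine tensor_dual_eq_zero hinj hf hb htor _ fun v => ?_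
    let ε : Tensor A (rightModule (mu f)) (dual f b) →+ EndCoker f :=
      tensorEval (rightModule (mu f)) hinj v
    have hε (m : EndCoker f) (β : dual f b) : ε (t m β) = m * mu f (coef β v) := rfl
    change ε _ = 0
    rw [map_sub, map_sub, map_sum]
    simp only [hε]
    refine LinearMap.ext fun s => ?_
    obtain ⟨y, rfl⟩ := cmk_surjective f s
    have hc (i : Fin n) : coef (inclDual (f := f) b (Pi.single i 1)) v = v.1 i := by
      rw [coef_inclDual hinj]
      simp [Pi.single_apply]
    simp only [LinearMap.sub_apply, LinearMap.sum_apply, Module.End.mul_apply, one_mul, mu_cmk, hd,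
      hc, map_coef, LinearMap.zero_apply]
    rw [Finset.sum_sub_distrib, ← map_sum, ← map_sum, ← map_sum]
    simp only [← mul_assoc]
    rw [← Finset.sum_mul, ← Finset.sum_mul]
    exact sub_self _
  have ht (m : EndCoker f) (β : dual f b) : tensorMapRight (rightModule (mu f)) (dualToEnd hb)
      (t m β) = btmul (mu f) m (dualToEndAux hb β) := rfl
  have hβc : dualToEndAux hb β = c := hβ
  have h := congrArg (tensorMapRight (rightModule (mu f)) (dualToEnd hb)) hz
  rw [map_sub, map_sub, map_sum, map_zero, ht, ht, hβc, dualToEndAux_selfDual,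
    Finset.sum_eq_zero, sub_zero] at h
  · exact (sub_eq_zero.1 h).symm
  · intro i _
    have h0 : dualToEndAux hb (inclDual b (Pi.single i 1)) = 0 :=
      (exact_inclDual_dualToEnd hb _).2 ⟨_, rfl⟩
    rw [ht, h0]
    exact tmul_zero (N := leftModule (mu f)) _

include hinj hf hb htor in
theorem isHomologicalEpi_mu : IsHomologicalEpi (mu f) := by
  have := projective_dual hinj hf hb htor
  exact ⟨isRingEpi_mu hinj hf hb htor, isZero_tor_of_projective_resolution (rightModule (mu f))
    (leftModule (mu f)) (inclDual_injective hinj) (exact_inclDual_dualToEnd hb)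
    (dualToEnd_surjective hb) (tensorMapRight_inclDual_injective hinj hf hb)⟩

theorem hasProjectiveDimensionLE_one_iff {R : Type u} [Ring R] {N₁ N₀ : Type u} [AddCommGroup N₁]
    [Module R N₁] [AddCommGroup N₀] [Module R N₀] [Module.Projective R N₀] {N : ModuleCat.{u} R}
    {i : N₁ →ₗ[R] N₀} {p : N₀ →ₗ[R] N} (hi : Function.Injective i) (hip : Function.Exact i p)
    (hp : Function.Surjective p) :
    HasProjectiveDimensionLE N 1 ↔ Module.Projective R N₁ := by
  let S : ShortComplex (ModuleCat.{u} R) := ShortComplex.mk (ModuleCat.ofHom i) (ModuleCat.ofHom p)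
    (ModuleCat.hom_ext (LinearMap.ext fun x => (hip _).2 ⟨x, rfl⟩))
  have hS : S.ShortExact :=
    { exact := (ShortComplex.ShortExact.moduleCat_exact_iff_function_exact S).2 hip
      mono_f := (ModuleCat.mono_iff_injective _).2 hi
      epi_g := (ModuleCat.epi_iff_surjective _).2 hp }
  have h₂ : Projective S.X₂ := (IsProjective.iff_projective N₀).1 inferInstance
  refine (hS.hasProjectiveDimensionLT_X₃_iff 0 h₂).trans ?_
  rw [zero_add, ← projective_iff_hasProjectiveDimensionLT_one]
  exact (IsProjective.iff_projective N₁).symm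

include hinj hf hb htor in
theorem hasProjectiveDimensionLE_mu : HasProjectiveDimensionLE (leftModule (mu f)) 1 := by
  have := projective_dual hinj hf hb htor
  rw [hasProjectiveDimensionLE_one_iff (inclDual_injective hinj) (exact_inclDual_dualToEnd hb)
    (dualToEnd_surjective hb)]
  infer_instance

end EndCokerLemmas

/-! ### Idempotent ideals. -/

section IdempotentIdeals

variable {A : Type u} [Ring A]

/-- Idempotent ideals of artinian rings are generated by idempotent elements. -/
theorem exists_isIdempotentElem_of_mul_self [IsArtinianRing A] (I : Ideal A) [I.IsTwoSided]
    (hI : I * I = I) :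
    ∃ e : A, IsIdempotentElem e ∧ I = Ideal.span {x | ∃ a b : A, x = a * e * b} := by
  let J := Ring.jacobson A
  obtain ⟨N, hN⟩ := IsSemiprimaryRing.isNilpotent (R := A)
  have hN' : J ^ N = ⊥ := hN
  have hmk := Ideal.Quotient.mk_surjective (I := J)
  obtain ⟨ē, hē, hspan⟩ :=
    IsSemisimpleRing.ideal_eq_span_idempotent (I.map (Ideal.Quotient.mk J))
  obtain ⟨x, hxI, hx⟩ := (Ideal.mem_map_iff_of_surjective _ hmk).1
    (hspan ▸ Ideal.mem_span_singleton_self ē : ē ∈ I.map (Ideal.Quotient.mk J))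
  have hxJ : x - x ^ 2 ∈ J := by
    rw [← Ideal.Quotient.eq_zero_iff_mem, map_sub, map_pow, hx, pow_two, hē.eq, sub_self]
  have hnil : (x - x ^ 2) ^ (N + 1) = 0 := by
    have := Ideal.pow_mem_pow hxJ N
    rw [hN', Ideal.mem_bot] at this
    rw [pow_succ, this, zero_mul]
  have hidem := isIdempotentElem_one_sub_one_sub_pow_pow x (N + 1) hnil
  -- A polynomial in `x` without constant term, so the lifted idempotent stays in I; the exponent N
  -- + 1 is positive even when N = 0.
  set e := 1 - (1 - x ^ (N + 1)) ^ (N + 1) with he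
  have heI : e ∈ I := by
    have hx0 : Ideal.Quotient.mk I x = 0 := Ideal.Quotient.eq_zero_iff_mem.2 hxI
    rw [← Ideal.Quotient.eq_zero_iff_mem, he]
    simp [hx0]
  have heē : Ideal.Quotient.mk J e = ē := by
    rw [he]
    simp only [map_sub, map_one, map_pow, hx, hē.pow_succ_eq, hē.one_sub.pow_succ_eq,
      sub_sub_cancel]
  refine ⟨e, hidem, le_antisymm ?_ ?_⟩
  · set K := Ideal.span {x | ∃ a b : A, x = a * e * b}
    have hKr (y : A) (hy : y ∈ K) (c : A) : y * c ∈ K := by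
      induction hy using Submodule.span_induction with
      | mem y hy =>
        obtain ⟨a, b, rfl⟩ := hy
        exact Ideal.subset_span ⟨a, b * c, by simp only [mul_assoc]⟩
      | zero => rw [zero_mul]; exact zero_mem _
      | add y z _ _ hy hz => rw [add_mul]; exact add_mem hy hz
      | smul a y _ hy => rw [smul_eq_mul, mul_assoc]; exact Ideal.mul_mem_left _ a hy
    have hbase (y : A) (hy : y ∈ I) : ∃ k ∈ K, y - k ∈ J := by
      have h1 : Ideal.Quotient.mk J y ∈ Ideal.span {ē} := hspan ▸ Ideal.mem_map_of_mem _ hy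
      obtain ⟨r, hr⟩ := Ideal.mem_span_singleton'.1 h1
      obtain ⟨r, rfl⟩ := hmk r
      refine ⟨r * e, Ideal.subset_span ⟨r, 1, (mul_one _).symm⟩, ?_⟩
      rw [← Ideal.Quotient.eq_zero_iff_mem, map_sub, map_mul, heē, hr, sub_self]
    -- Since I = I · I and I ⊆ K + J, each step multiplies the error term by J, which is nilpotent.
    have hstep (k : ℕ) : I ≤ K ⊔ J ^ k := by
      induction k with
      | zero => rw [Submodule.pow_zero, Ideal.one_eq_top, sup_top_eq]; exact le_top
      | succ k ih =>
        conv_lhs => rw [← hI]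
        refine Ideal.mul_le.2 fun y hy z hz => ?_
        obtain ⟨y₁, hy₁, hy₂⟩ := hbase y hy
        obtain ⟨z₁, hz₁, z₂, hz₂, rfl⟩ := Submodule.mem_sup.1 (ih hz)
        have : y * (z₁ + z₂) = (y₁ * (z₁ + z₂) + (y - y₁) * z₁) + (y - y₁) * z₂ := by noncomm_ring
        rw [this]
        refine Submodule.add_mem_sup (add_mem (hKr _ hy₁ _) (Ideal.mul_mem_left _ _ hz₁)) ?_
        rw [Ideal.IsTwoSided.pow_succ]
        exact Ideal.mul_mem_mul hy₂ hz₂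
    have := hstep N
    rwa [hN', sup_bot_eq] at this
  · refine Ideal.span_le.2 ?_
    rintro _ ⟨a, b, rfl⟩
    exact I.mul_mem_right _ (I.mul_mem_left _ heI)

/-- A projective idempotent ideal gives a homological epimorphism. -/
theorem isHomologicalEpi_quotient_mk (I : Ideal A) [I.IsTwoSided] (hI : I * I = I)
    [Module.Projective A I] : IsHomologicalEpi (Ideal.Quotient.mk I) := by
  let p : A →ₗ[A] leftModule (Ideal.Quotient.mk I) :=
    { toFun := fun a => Ideal.Quotient.mk I a
      map_add' := fun a a' => map_add (Ideal.Quotient.mk I) a a'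
      map_smul' := fun a a' => map_mul (Ideal.Quotient.mk I) a a' }
  refine ⟨isRingEpi_of_surjective Ideal.Quotient.mk_surjective,
    isZero_tor_of_projective_resolution _ _ (i := Submodule.subtype I) (p := p)
      (Submodule.subtype_injective I) (fun x => ?_) Ideal.Quotient.mk_surjective ?_⟩
  · exact Ideal.Quotient.eq_zero_iff_mem.trans
      ⟨fun h => ⟨⟨x, h⟩, rfl⟩, fun ⟨y, hy⟩ => hy ▸ y.2⟩
  · let R := rightModule (Ideal.Quotient.mk I)
    -- (A/I) ⊗ I = 0: for a, a' in I, x ⊗ aa' = xa ⊗ a' = 0, and such products generate I.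
    let K : Submodule A I :=
      { carrier := {a | ∀ x : R, tmul (A := A) x a = 0}
        add_mem' := fun {a a'} h h' x => by rw [tmul_add, h, h', add_zero]
        zero_mem' := fun x => tmul_zero x
        smul_mem' := fun r a h x => by rw [← smul_tmul, h] }
    have hR (a : A) (ha : a ∈ I) (x : R) : op a • x = 0 := by
      suffices H : ∀ x : A ⧸ I, x * Ideal.Quotient.mk I a = 0 from H x
      intro x
      rw [Ideal.Quotient.eq_zero_iff_mem.2 ha, mul_zero]
    have hK : I ≤ K.map I.subtype := by
      conv_lhs => rw [← hI]
      refine Ideal.mul_le.2 fun a ha a' ha' => ⟨a • ⟨a', ha'⟩, fun x => ?_, rfl⟩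
      rw [← smul_tmul, hR a ha, zero_tmul]
    have hz (z : Tensor A R I) : z = 0 := by
      induction z using tensor_induction with
      | h0 => rfl
      | ht x a =>
        obtain ⟨a', ha', h⟩ := hK a.2
        rw [← Subtype.ext h]
        exact ha' x
      | ha x y hx hy => rw [hx, hy, add_zero]
    exact fun z z' _ => (hz z).trans (hz z').symm

end IdempotentIdeals

/-! ### The kernel of μ as a direct summand of A × A^n. -/

section Kernel

variable {A B : Type u} [Ring A] [Ring B] {f : A →+* B} {n : ℕ} {b : Fin n → B}

/-- The map `A × A ^ n → dual f b`, `(a, α) ↦ f ∘ α - a b`, dual to the inclusion of the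
relations into `A × A ^ n`. -/
def dualPresentation (f : A →+* B) (b : Fin n → B) : A × (Fin n → A) →ₗ[A] dual f b :=
  inclDual b ∘ₗ LinearMap.snd A A (Fin n → A) -
    LinearMap.toSpanSingleton A (dual f b) (selfDual f b) ∘ₗ LinearMap.fst A A (Fin n → A)

theorem dualPresentation_apply (x : A × (Fin n → A)) :
    dualPresentation f b x = inclDual b x.2 - x.1 • selfDual f b := rfl

theorem dualPresentation_eq_zero_iff (x : A × (Fin n → A)) :
    dualPresentation f b x = 0 ↔ ∀ i, f (x.2 i) = f x.1 * b i := by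
  rw [dualPresentation_apply, sub_eq_zero, ← vec_injective.eq_iff, funext_iff]
  exact Iff.rfl

theorem mu_eq_zero_iff_generators (hb : Function.Surjective (dot f b)) (a : A) :
    mu f a = 0 ↔ ∀ i, ∃ α, f α = f a * b i := by
  rw [mu_eq_zero_iff]
  refine ⟨fun h i => h (b i), fun h y => ?_⟩
  choose α hα using h
  obtain ⟨v, hv⟩ := hb y
  refine ⟨∑ i, α i * v i, ?_⟩
  have hv' : ∑ i, b i * f (v i) = y := hv
  simp only [map_sum, map_mul, hα, ← hv', Finset.mul_sum, mul_assoc]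

/-- The kernel of `dualPresentation f b` consists of the (a, α) with f(α i) = f(a) b i. Injectivity
of f makes α a function of a, so this kernel is a copy of ker μ; it splits off when the range is
projective. -/
theorem kernel_mu_of_projective_range (hinj : Function.Injective f)
    (hb : Function.Surjective (dot f b))
    [Module.Projective A (LinearMap.range (dualPresentation f b))] :
    RingHom.ker (mu f) * RingHom.ker (mu f) = RingHom.ker (mu f) ∧
      Module.Projective A (RingHom.ker (mu f)) := by
  set I := RingHom.ker (mu f)
  have hI (a : A) : a ∈ I ↔ ∀ i, ∃ α, f α = f a * b i :=
    RingHom.mem_ker.trans (mu_eq_zero_iff_generators hb a)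
  obtain ⟨s, hs⟩ := Module.projective_lifting_property (dualPresentation f b).rangeRestrict
    LinearMap.id (dualPresentation f b).surjective_rangeRestrict
  -- The projection onto the kernel of `dualPresentation f b`.
  let ρ : A × (Fin n → A) →ₗ[A] A × (Fin n → A) :=
    LinearMap.id - s ∘ₗ (dualPresentation f b).rangeRestrict
  have hρ (x) : dualPresentation f b (ρ x) = 0 := by
    have h1 : dualPresentation f b (s ((dualPresentation f b).rangeRestrict x)) =
        dualPresentation f b x :=
      congrArg Subtype.val (LinearMap.congr_fun hs ((dualPresentation f b).rangeRestrict x))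
    change dualPresentation f b (x - s ((dualPresentation f b).rangeRestrict x)) = 0
    rw [map_sub, h1, sub_self]
  have hρ' (x) (hx : dualPresentation f b x = 0) : ρ x = x := by
    have h1 : (dualPresentation f b).rangeRestrict x = 0 := Subtype.ext hx
    change x - s ((dualPresentation f b).rangeRestrict x) = x
    rw [h1, map_zero, sub_zero]
  have hρI (x) : (ρ x).1 ∈ I :=
    (hI _).2 fun i => ⟨_, (dualPresentation_eq_zero_iff _).1 (hρ x) i⟩
  choose α hα using fun (a : I) => (hI a).1 a.2
  let i : I →ₗ[A] A × (Fin n → A) :=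
    { toFun := fun a => (a, α a)
      map_add' := fun a a' => Prod.ext rfl (funext fun i => hinj (by
        rw [hα]
        change f (a.1 + a'.1) * b i = f (α a i + α a' i)
        rw [map_add, map_add, hα, hα, add_mul]))
      map_smul' := fun c a => Prod.ext rfl (funext fun i => hinj (by
        rw [hα]
        change f (c * a.1) * b i = f (c * α a i)
        rw [map_mul, map_mul, hα, mul_assoc])) }
  have hρi (a : I) : ρ (i a) = i a := hρ' _ ((dualPresentation_eq_zero_iff _).2 (hα a))
  have hαI (a : I) (j : Fin n) : α a j ∈ I := by
    refine RingHom.mem_ker.2 ((mu_eq_zero_iff f _).2 fun y => ?_)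
    rw [hα, mul_assoc]
    exact (mu_eq_zero_iff f a.1).1 (RingHom.mem_ker.1 a.2) _
  constructor
  · refine le_antisymm Ideal.mul_le_left fun a ha => ?_
    -- Applying ρ to this expansion writes `a` as a sum of products. The left factors `a` and `α j`
    -- lie in I, and so do the right factors, being first coordinates of values of ρ.
    have h1 : i ⟨a, ha⟩ = a • ((1, 0) : A × (Fin n → A)) +
        ∑ j, α ⟨a, ha⟩ j • ((0, Pi.single j 1) : A × (Fin n → A)) := by
      refine Prod.ext ?_ (funext fun j => ?_)
      · simp [i, Prod.fst_sum]
      · simp [i, Prod.snd_sum, Pi.single_apply]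
    have h2 := congrArg Prod.fst (hρi ⟨a, ha⟩)
    rw [h1, map_add, map_sum, ← h1] at h2
    simp only [map_smul, Prod.fst_add, Prod.fst_sum, Prod.smul_fst, smul_eq_mul] at h2
    change _ = a at h2
    rw [← h2]
    exact add_mem (Ideal.mul_mem_mul ha (hρI _))
      (sum_mem fun j _ => Ideal.mul_mem_mul (hαI _ j) (hρI _))
  · refine Module.Projective.of_split i ((LinearMap.fst A A (Fin n → A) ∘ₗ ρ).codRestrict I hρI) ?_
    ext1 a
    exact Subtype.ext (congrArg Prod.fst (hρi a))

end Kernel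

/-! ### Ext^1(B, A) as the cokernel of A × A^n → K*. -/

section ExtLemmas

variable {A B : Type u} [Ring A] [Ring B] {f : A →+* B} {n : ℕ} {b : Fin n → B}

/-- `Ext_A^1(B, A)` is the cokernel of the map `A × A ^ n → dual f b`. -/
theorem exists_dual_to_ext (hinj : Function.Injective f) (hf : IsRingEpi f)
    (hb : Function.Surjective (dot f b))
    (htor : Limits.IsZero (Tor 1 (rightModule f) (leftModule f))) :
    ∃ δ : dual f b →ₗ[A] extLeft (rightModule f) 1, Function.Surjective δ ∧
      Function.Exact (LinearMap.range (dualPresentation f b)).subtype δ := by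
  obtain ⟨κ, q, hκ1, hκ2, hq, hκ, hκq, hqs⟩ := exists_resolution hinj hb
  let S : ShortComplex (ModuleCat.{u} Aᵐᵒᵖ) :=
    ShortComplex.mk (ModuleCat.ofHom κ) (ModuleCat.ofHom q)
      (ModuleCat.hom_ext (LinearMap.ext fun x => (hκq _).2 ⟨x, rfl⟩))
  have hS : S.ShortExact :=
    { exact := (ShortComplex.ShortExact.moduleCat_exact_iff_function_exact S).2 hκq
      mono_f := (ModuleCat.mono_iff_injective _).2 hκ
      epi_g := (ModuleCat.epi_iff_surjective _).2 hqs }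
  have hproj : Projective S.X₂ := (IsProjective.iff_projective (A × (Fin n → A))).1 inferInstance
  let AA := ModuleCat.of Aᵐᵒᵖ A
  let h (β : dual f b) : S.X₁ ⟶ AA := ModuleCat.ofHom (dualHom hinj β)
  have h_add (β β') : h (β + β') = h β + h β' :=
    ModuleCat.hom_ext (LinearMap.ext fun v => map_add (evalDual hinj v) β β')
  have h_smul (a β) : h (a • β) = h β ≫ regularMulLeft a :=
    ModuleCat.hom_ext (LinearMap.ext fun v => map_smul (evalDual hinj v) a β)
  let δ : dual f b →ₗ[A] extLeft (rightModule f) 1 :=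
    { toFun := fun β => hS.extClass.comp (Abelian.Ext.mk₀ (h β)) (add_zero 1)
      map_add' := fun β β' => by
        rw [h_add, Abelian.Ext.mk₀_add, Abelian.Ext.comp_add]
        rfl
      map_smul' := fun a β => by
        rw [h_smul, ← Abelian.Ext.mk₀_comp_mk₀]
        exact (Abelian.Ext.comp_assoc_of_third_deg_zero _ _ _ _).symm }
  have hκc (v) : (κ v).1 = -coef (selfDual f b) v := hinj (by
    rw [hκ1, map_neg, map_coef]
    rfl)
  have hcoef (x : A × (Fin n → A)) (v) : coef (dualPresentation f b x) v =
      x.1 * (κ v).1 + ∑ i, x.2 i * v.1 i := by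
    change evalDual hinj v _ = _
    rw [dualPresentation_apply, map_sub, map_smul]
    change coef (inclDual b x.2) v - x.1 * coef (selfDual f b) v = _
    rw [coef_inclDual hinj, hκc, mul_neg, sub_eq_add_neg, add_comm]
  refine ⟨δ, fun x => ?_, fun β => ⟨fun hβ => ?_, ?_⟩⟩
  -- Ext^1 vanishes on the projective middle term, so every class is the connecting image of some
  -- map K → A.
  · obtain ⟨y, hy⟩ := Abelian.Ext.contravariant_sequence_exact₃ hS AA
      (show Abelian.Ext.{u} S.X₃ AA 1 from x)
      (Abelian.Ext.eq_zero_of_projective _) (add_zero 1)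
    obtain ⟨g, rfl⟩ := Abelian.Ext.homEquiv₀.symm.surjective y
    obtain ⟨β, hβ⟩ := exists_dual_coef hinj hf hb htor (ModuleCat.Hom.hom g)
    have hg : h β = g := ModuleCat.hom_ext (LinearMap.ext hβ)
    refine ⟨β, ?_⟩
    rw [← hy, ← hg]
    rfl
  · obtain ⟨y, hy⟩ := Abelian.Ext.contravariant_sequence_exact₁ hS AA (Abelian.Ext.mk₀ (h β))
      (add_zero 1) hβ
    obtain ⟨g, rfl⟩ := Abelian.Ext.homEquiv₀.symm.surjective y
    rw [Abelian.Ext.homEquiv₀_symm_apply, Abelian.Ext.mk₀_comp_mk₀] at hy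
    have hg : S.f ≫ g = h β := Abelian.Ext.homEquiv₀.symm.injective (by simpa using hy)
    let g' : A × (Fin n → A) →ₗ[Aᵐᵒᵖ] A := g.hom
    have hg' (v) : g' (κ v) = coef β v := LinearMap.congr_fun (congrArg ModuleCat.Hom.hom hg) v
    -- An extension of the functional to A × A^n is recovered from its values on the standard basis.
    refine ⟨⟨_, (g' (1, 0), fun i => g' (0, Pi.single i 1)), rfl⟩, ?_⟩
    refine dual_ext hf hb fun v => ?_
    rw [← hg']
    refine (hcoef _ v).trans ?_
    have hx : κ v = op (κ v).1 • ((1, 0) : A × (Fin n → A)) +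
        ∑ i, op (v.1 i) • ((0, Pi.single i 1) : A × (Fin n → A)) := by
      refine Prod.ext ?_ (funext fun j => ?_)
      · simp [Prod.fst_sum]
      · simp [Prod.snd_sum, Pi.single_apply, hκ2]
    conv_rhs => rw [hx, map_add, map_sum]
    simp only [map_smul]
    rfl
  · rintro ⟨⟨_, x, rfl⟩, rfl⟩
    let g : A × (Fin n → A) →ₗ[Aᵐᵒᵖ] A :=
      { toFun := fun y => x.1 * y.1 + ∑ i, x.2 i * y.2 i
        map_add' := fun y z => by
          simp only [Prod.fst_add, Prod.snd_add, Pi.add_apply, mul_add, Finset.sum_add_distrib]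
          abel
        map_smul' := fun a y => by
          simp only [Prod.smul_fst, Prod.smul_snd, Pi.smul_apply, RingHom.id_apply, smul_add,
            Finset.smul_sum, mul_smul_comm] }
    have hg : h (dualPresentation f b x) = S.f ≫ ModuleCat.ofHom g :=
      ModuleCat.hom_ext (LinearMap.ext fun v => (hcoef x v).trans (by
        rw [← hκ2]
        rfl))
    change hS.extClass.comp (Abelian.Ext.mk₀ (h (dualPresentation f b x))) (add_zero 1) = 0
    rw [hg, ← Abelian.Ext.mk₀_comp_mk₀]
    exact hS.extClass_comp_assoc _

end ExtLemmas

/-! ### Finiteness over k and conclusion. -/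

theorem exists_dot_surjective {k : Type*} [CommRing k] {A B : Type u} [Ring A] [Ring B]
    [Algebra k A] [Algebra k B] [Module.Finite k B] (lam : A →ₐ[k] B) :
    ∃ (n : ℕ) (b : Fin n → B), Function.Surjective (dot (lam : A →+* B) b) := by
  obtain ⟨n, b, hb⟩ := Module.Finite.exists_fin (R := k) (M := B)
  refine ⟨n, b, fun y => ?_⟩
  suffices H : ∀ y : B, ∃ v : Fin n → A, ∑ i, b i * lam (v i) = y from H y
  intro y
  obtain ⟨c, rfl⟩ := (Submodule.mem_span_range_iff_exists_fun k).1
    (hb ▸ Submodule.mem_top : y ∈ Submodule.span k (Set.range b))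
  refine ⟨fun i => algebraMap k A (c i), Finset.sum_congr rfl fun i _ => ?_⟩
  rw [AlgHom.commutes, Algebra.smul_def, Algebra.commutes]

theorem projective_relations {A B : Type u} [Ring A] [Ring B] {f : A →+* B} {n : ℕ}
    {b : Fin n → B} (hinj : Function.Injective f) (hb : Function.Surjective (dot f b))
    (hpd : HasProjectiveDimensionLE (rightModule f) 1) :
    Module.Projective Aᵐᵒᵖ (relations f b) := by
  obtain ⟨κ, q, -, -, -, hκ, hκq, hqs⟩ := exists_resolution hinj hb
  exact (hasProjectiveDimensionLE_one_iff hκ hκq hqs).1 hpd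

theorem isNoetherian_right (k : Type*) [CommRing k] [IsArtinianRing k] (A : Type u) [Ring A]
    [Algebra k A] [Module.Finite k A] (n : ℕ) : IsNoetherian Aᵐᵒᵖ (Fin n → A) := by
  have : IsScalarTower k Aᵐᵒᵖ (Fin n → A) :=
    ⟨fun c a v => funext fun i => by simp⟩
  have : IsNoetherian k (Fin n → A) := inferInstance
  exact isNoetherian_of_tower k this

end RingEpi

end

theorem mainTheorem9 {k : Type*} [CommRing k] [IsArtinianRing k]
    {A B : Type u} [Ring A] [Ring B] [Algebra k A] [Algebra k B]
    [Module.Finite k A] [Module.Finite k B]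
    (lam : A →ₐ[k] B)
    (h_inj : Function.Injective lam)
    (h_epi : RingEpi.IsRingEpi (lam : A →+* B))
    (h_pd : HasProjectiveDimensionLE (RingEpi.rightModule (lam : A →+* B)) 1)
    (h_tor : Limits.IsZero
      (RingEpi.Tor 1 (RingEpi.rightModule (lam : A →+* B)) (RingEpi.leftModule (lam : A →+* B)))) :
    RingEpi.IsHomologicalEpi (RingEpi.mu (lam : A →+* B)) ∧
    HasProjectiveDimensionLE (RingEpi.leftModule (RingEpi.mu (lam : A →+* B))) 1 ∧
    (HasProjectiveDimensionLE (RingEpi.extLeft (RingEpi.rightModule (lam : A →+* B)) 1) 1 →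
      RingEpi.IsStratifyingIdeal (RingHom.ker (RingEpi.mu (lam : A →+* B)))) := by
  obtain ⟨n, b, hb⟩ := RingEpi.exists_dot_surjective lam
  have hinj : Function.Injective (lam : A →+* B) := h_inj
  have := RingEpi.isNoetherian_right k A n
  have := RingEpi.projective_relations hinj hb h_pd
  refine ⟨RingEpi.isHomologicalEpi_mu hinj h_epi hb h_tor,
    RingEpi.hasProjectiveDimensionLE_mu hinj h_epi hb h_tor, fun h_ext => ?_⟩
  obtain ⟨δ, hδ, hex⟩ := RingEpi.exists_dual_to_ext hinj h_epi hb h_tor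
  have := RingEpi.projective_dual hinj h_epi hb h_tor
  -- The range of A × A^n → K* is a syzygy of Ext^1(B, A), since K* is projective.
  have := (RingEpi.hasProjectiveDimensionLE_one_iff (Submodule.subtype_injective _) hex hδ).1 h_ext
  have : IsArtinianRing A := IsArtinianRing.of_finite k A
  obtain ⟨hI, _⟩ := RingEpi.kernel_mu_of_projective_range hinj hb
  exact ⟨RingEpi.exists_isIdempotentElem_of_mul_self _ hI,
    RingEpi.isHomologicalEpi_quotient_mk _ hI⟩
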